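/- Let $K=[0,1]^2\subset\mathbb R^2$, let $\mathcal M(K)$ be the space of finite signed Borel measures on $\mathbb R^2$ supported in $K$, with the total variation norm $\|\cdot\|_{\mathcal M}$, and let $\mathrm D\otimes\mathrm I=\partial_1$, $\mathrm I\otimes\mathrm D=\partial_2$, $\mathrm D\otimes\mathrm D=\partial_1\partial_2$ be the distributional derivatives on the real distributions $\mathcal D'(\mathbb R^2)$. Let $$\mathcal M_{\mathrm D\otimes\mathrm D,0}(K)=\{f\in\mathcal D'(\mathbb R^2):\ [\mathrm D\otimes\mathrm D]\{f\}\in\mathcal M(K),\ \langle f,\phi\rangle=0\ \text{ for all }\phi\in C_c^\infty(\mathbb R^2\setminus K)\},$$ and for $\theta\in\,]0,1]$ and $f\in\mathcal M_{\mathrm D\otimes\mathrm D,0}(K)$ let $$\|f\|_\theta=\theta\,\|[\mathrm D\otimes\mathrm D]\{f\}\|_{\mathcal M}+(1-\theta)\big(\|[\mathrm I\otimes\mathrm D]\{f\}\|_{\mathcal M}+\|[\mathrm D\otimes\mathrm I]\{f\}\|_{\mathcal M}\big).$$ 1. For every $f\in\mathcal M_{\mathrm D\otimes\mathrm D,0}(K)$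 the distributions $[\mathrm D\otimes\mathrm D]\{f\}$, $[\mathrm I\otimes\mathrm D]\{f\}$ and $[\mathrm D\otimes\mathrm I]\{f\}$ are given by unique measures in $\mathcal M(K)$, so that $\|f\|_\theta$ is well defined. For every $\theta\in\,]0,1]$, $\|\cdot\|_\theta$ is a norm, and these norms are all equivalent: for all $\theta,\theta'\in\,]0,1]$ there is a constant $C>0$ such that $\|f\|_\theta\le C\|f\|_{\theta'}$ for all $f\in\mathcal M_{\mathrm D\otimes\mathrm D,0}(K)$. 2. For every $\theta\in\,]0,1]$, $\big(\mathcal M_{\mathrm D\otimes\mathrm D,0}(K),\|\cdot\|_\theta\big)$ is a Banach space. 3. Let $C_0(\mathbb R^2)$ be the space of real continuous functions on $\mathbb R^2$ that vanish at infinity. Let $[\mathrm D\otimes\mathrm D]\{C_0(\mathbb R^2)\}$ carry the norm $\|[\mathrm D\otimes\mathrm D]\{\phi\}\|=\|\phi\|_\infty$ (the map $\phi\mapsto[\mathrm D\otimes\mathrm D]\{\phi\}$ is injective on $C_0(\mathbb R^2)$), and for $f\in\mathcal M_{\mathrm D\otimes\mathrm D,0}(K)$ and $\phi\in C_0(\mathbb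 R^2)$ put $\langle f,[\mathrm D\otimes\mathrm D]\{\phi\}\rangle=\int\phi\,\mathrm dm$, where $m=[\mathrm D\otimes\mathrm D]\{f\}$. Then $$M_0=\{v\in[\mathrm D\otimes\mathrm D]\{C_0(\mathbb R^2)\}:\ \langle f,v\rangle=0\ \text{ for all } f\in\mathcal M_{\mathrm D\otimes\mathrm D,0}(K)\}$$ is a closed subspace, and $\mathcal M_{\mathrm D\otimes\mathrm D,0}(K)$ with the norm $\|[\mathrm D\otimes\mathrm D]\{\cdot\}\|_{\mathcal M}$ is the dual space of $[\mathrm D\otimes\mathrm D]\{C_0(\mathbb R^2)\}/M_0$ with the quotient norm: the map $f\mapsto\big([v]\mapsto\langle f,v\rangle\big)$ is a linear isometric bijection onto this dual. -/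

import Mathlib

open MeasureTheory Filter Topology TopologicalSpace Set
open scoped Distributions LineDeriv ZeroAtInfty

noncomputable section

namespace MixedTV

/-! ### Distributions on the plane and their mixed derivatives -/

/-- Real test functions on the plane: smooth with compact support. -/
abbrev TestFn : Type := 𝓓((⊤ : Opens (ℝ × ℝ)), ℝ)

/-- Real distributions on the plane. -/
abbrev Distr : Type := 𝓓'((⊤ : Opens (ℝ × ℝ)), ℝ)

/-- `D ⊗ I`: the distributional derivative in the first variable. -/
def DI : Distr →ₗ[ℝ] Distr := (LineDeriv.lineDerivOpCLM ℝ Distr ((1, 0) : ℝ × ℝ)).toLinearMap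

/-- `I ⊗ D`: the distributional derivative in the second variable. -/
def ID : Distr →ₗ[ℝ] Distr := (LineDeriv.lineDerivOpCLM ℝ Distr ((0, 1) : ℝ × ℝ)).toLinearMap

/-- `D ⊗ D`: the mixed distributional derivative. -/
def DD : Distr →ₗ[ℝ] Distr := DI ∘ₗ ID

theorem DD_apply (T : Distr) (ψ : TestFn) :
    DD T ψ = T (∂_{((0, 1) : ℝ × ℝ)} (∂_{((1, 0) : ℝ × ℝ)} ψ)) := by
  change (∂_{((1, 0) : ℝ × ℝ)} (∂_{((0, 1) : ℝ × ℝ)} T)) ψ = _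
  rw [Distribution.lineDerivOp_apply_apply, map_neg, Distribution.lineDerivOp_apply_apply,
    map_neg, neg_neg]

/-! ### Bounded signed measures on the unit square -/

/-- The unit square `K = [0,1]²`. -/
def K : Set (ℝ × ℝ) := Icc 0 1 ×ˢ Icc 0 1

instance isFiniteMeasure_variation (m : SignedMeasure (ℝ × ℝ)) :
    IsFiniteMeasure m.variation := by
  rw [← SignedMeasure.totalVariation_eq_variation, SignedMeasure.totalVariation]
  infer_instance

/-- `M(K)`: the finite signed Borel measures on the plane that are supported in `K`. -/
def MK : Submodule ℝ (SignedMeasure (ℝ × ℝ)) where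
  carrier := {m | m.variation Kᶜ = 0}
  zero_mem' := by simp
  add_mem' := by
    intro a b ha hb
    have h := VectorMeasure.variation_add_le (μ := a) (ν := b) Kᶜ
    simp only [mem_ofPred_eq] at *
    simpa [ha, hb] using h
  smul_mem' := by
    intro c a ha
    simp only [mem_ofPred_eq] at *
    simp [VectorMeasure.variation_smul, ha]

/-- The total variation norm of a finite signed measure. -/
def tvNorm (m : SignedMeasure (ℝ × ℝ)) : ℝ := (m.variation univ).toReal

/-- The distribution `T` is the finite signed measure `m`. -/
def IsRepresentedBy (T : Distr) (m : SignedMeasure (ℝ × ℝ)) : Prop :=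
  ∀ ψ : TestFn, T ψ = ∫ᵛ x, ψ x ∂•m

open Classical in
/-- The measure in `M(K)` that the distribution `T` is (`0` if `T` is not in `M(K)`). -/
def measureOf (T : Distr) : SignedMeasure (ℝ × ℝ) :=
  if h : ∃ m ∈ MK, IsRepresentedBy T m then h.choose else 0

/-- `‖T‖_M` for a distribution `T` in `M(K)`. -/
def normM (T : Distr) : ℝ := tvNorm (measureOf T)

theorem integrable_testFn (m : SignedMeasure (ℝ × ℝ)) (ψ : TestFn) : m.Integrable ψ :=
  ψ.continuous.integrable_of_hasCompactSupport ψ.hasCompactSupport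

theorem integrable_C0 (m : SignedMeasure (ℝ × ℝ)) (φ : C₀(ℝ × ℝ, ℝ)) : m.Integrable φ :=
  φ.toBCF.integrable m.variation

/-! ### The native space and its norms -/

/-- The distributions `f` with `(D ⊗ D) f ∈ M(K)` that vanish on all test functions with
(compact) support in the complement of `K`. -/
def nativeSpace : Submodule ℝ Distr where
  carrier := {f | (∃ m ∈ MK, IsRepresentedBy (DD f) m) ∧ Distribution.IsVanishingOn f Kᶜ}
  zero_mem' := ⟨⟨0, zero_mem _, fun ψ => by simp⟩, fun ψ _ => by simp⟩
  add_mem' := by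
    rintro f g ⟨⟨m, hm, hfm⟩, hf⟩ ⟨⟨n, hn, hgn⟩, hg⟩
    refine ⟨⟨m + n, add_mem hm hn, fun ψ => ?_⟩, fun ψ hψ => ?_⟩
    · rw [map_add, VectorMeasure.integral_add_vectorMeasure (integrable_testFn m ψ)
        (integrable_testFn n ψ), ← hfm, ← hgn]
      rfl
    · change f ψ + g ψ = 0
      rw [hf ψ hψ, hg ψ hψ, add_zero]
  smul_mem' := by
    rintro c f ⟨⟨m, hm, hfm⟩, hf⟩
    refine ⟨⟨c • m, MK.smul_mem c hm, fun ψ => ?_⟩, fun ψ hψ => ?_⟩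
    · rw [map_smul, VectorMeasure.integral_smul_vectorMeasure, ← hfm]
      rfl
    · change c • f ψ = 0
      rw [hf ψ hψ, smul_zero]

/-- `‖∇ f‖_M = ‖(I ⊗ D) f‖_M + ‖(D ⊗ I) f‖_M`. -/
def normGrad (f : nativeSpace) : ℝ := normM (ID f) + normM (DI f)

/-- `‖f‖_θ = θ ‖(D ⊗ D) f‖_M + (1 - θ) ‖∇ f‖_M`. -/
def normTheta (θ : ℝ) (f : nativeSpace) : ℝ := θ * normM (DD f) + (1 - θ) * normGrad f

/-- `N` is a norm on the real vector space `V`. -/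
structure IsNorm {V : Type*} [AddCommGroup V] [Module ℝ V] (N : V → ℝ) : Prop where
  nonneg : ∀ f, 0 ≤ N f
  eq_zero_iff : ∀ f, N f = 0 ↔ f = 0
  smul : ∀ (c : ℝ) f, N (c • f) = |c| * N f
  add_le : ∀ f g, N (f + g) ≤ N f + N g

/-- Every sequence that is Cauchy for `N` converges for `N`. -/
def IsCompleteFor {V : Type*} [AddCommGroup V] (N : V → ℝ) : Prop :=
  ∀ u : ℕ → V, (∀ ε > 0, ∃ n₀, ∀ n ≥ n₀, ∀ k ≥ n₀, N (u n - u k) < ε) →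
    ∃ f, Tendsto (fun n => N (u n - f)) atTop (𝓝 0)

/-! ### The space `[D ⊗ D]{C₀(ℝ²)}` -/

theorem locallyIntegrableOn_C0 (φ : C₀(ℝ × ℝ, ℝ)) :
    LocallyIntegrableOn φ ((⊤ : Opens (ℝ × ℝ)) : Set (ℝ × ℝ)) volume :=
  (φ.continuous.locallyIntegrable).locallyIntegrableOn _

/-- A function `φ ∈ C₀(ℝ²)` as the distribution `ψ ↦ ∫ ψ φ`. -/
def C0toDistr : C₀(ℝ × ℝ, ℝ) →ₗ[ℝ] Distr where
  toFun φ :=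
    { toLinearMap := (TestFunction.integralAgainstBilinCLM
        (ContinuousLinearMap.mul ℝ ℝ) volume φ : TestFn →L[ℝ] ℝ).toLinearMap
      cont := (TestFunction.integralAgainstBilinCLM
        (ContinuousLinearMap.mul ℝ ℝ) volume φ : TestFn →L[ℝ] ℝ).cont }
  map_add' φ χ := by
    ext ψ
    have h := TestFunction.integrable_bilin (ContinuousLinearMap.mul ℝ ℝ)
      (locallyIntegrableOn_C0 φ) ψ
    have h' := TestFunction.integrable_bilin (ContinuousLinearMap.mul ℝ ℝ)
      (locallyIntegrableOn_C0 χ) ψ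
    change TestFunction.integralAgainstBilinCLM (ContinuousLinearMap.mul ℝ ℝ) volume (φ + χ) ψ =
      TestFunction.integralAgainstBilinCLM (ContinuousLinearMap.mul ℝ ℝ) volume φ ψ +
        TestFunction.integralAgainstBilinCLM (ContinuousLinearMap.mul ℝ ℝ) volume χ ψ
    rw [TestFunction.integralAgainstBilinCLM_eq_integral (locallyIntegrableOn_C0 φ),
      TestFunction.integralAgainstBilinCLM_eq_integral (locallyIntegrableOn_C0 χ),
      TestFunction.integralAgainstBilinCLM_eq_integral (locallyIntegrableOn_C0 (φ + χ)),
      ← integral_add h h']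
    simp [mul_add]
  map_smul' c φ := by
    ext ψ
    change TestFunction.integralAgainstBilinCLM (ContinuousLinearMap.mul ℝ ℝ) volume (c • φ) ψ =
      c * TestFunction.integralAgainstBilinCLM (ContinuousLinearMap.mul ℝ ℝ) volume φ ψ
    rw [TestFunction.integralAgainstBilinCLM_eq_integral (locallyIntegrableOn_C0 φ),
      TestFunction.integralAgainstBilinCLM_eq_integral (locallyIntegrableOn_C0 (c • φ)),
      ← integral_const_mul]
    simp [mul_left_comm]

theorem C0toDistr_apply (φ : C₀(ℝ × ℝ, ℝ)) (ψ : TestFn) :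
    C0toDistr φ ψ = ∫ x, ψ x * φ x := by
  change TestFunction.integralAgainstBilinCLM _ volume φ ψ = _
  rw [TestFunction.integralAgainstBilinCLM_eq_integral (locallyIntegrableOn_C0 φ)]
  rfl

/-- The test function `t ↦ g (x - t)`. -/
def reflect (g : TestFn) (x : ℝ × ℝ) : TestFn where
  toFun t := g (x - t)
  contDiff' := g.contDiff.comp (contDiff_const.sub contDiff_id)
  hasCompactSupport' := g.hasCompactSupport.comp_homeomorph (Homeomorph.subLeft x)
  tsupport_subset' := fun _ _ => trivial

theorem reflect_apply (g : TestFn) (x t : ℝ × ℝ) : reflect g x t = g (x - t) := rfl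

theorem lineDeriv_testFn (g : TestFn) (w x : ℝ × ℝ) : (∂_{w} g) x = fderiv ℝ g x w := by
  rw [TestFunction.lineDerivOp_eq_lineDerivCLM ℝ,
    TestFunction.lineDerivCLM_apply_of_le (by simp)]
  exact (g.contDiff.differentiable (by simp) x).lineDeriv_eq_fderiv

theorem lineDeriv_reflect (g : TestFn) (x w : ℝ × ℝ) :
    ∂_{w} (reflect g x) = - reflect (∂_{w} g) x := by
  ext t
  change _ = - (∂_{w} g) (x - t)
  rw [lineDeriv_testFn, lineDeriv_testFn]
  have h1 : HasFDerivAt g (fderiv ℝ g (x - t)) (x - t) :=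
    (g.contDiff.differentiable (by simp) (x - t)).hasFDerivAt
  have h2 : HasFDerivAt (fun t => g (x - t)) ((fderiv ℝ g (x - t)).comp
      (-ContinuousLinearMap.id ℝ (ℝ × ℝ))) t :=
    h1.comp t ((hasFDerivAt_id t).const_sub x)
  have h3 : fderiv ℝ (reflect g x) t = _ := h2.fderiv
  rw [h3]
  simp

/-- If the convolution of `φ ∈ C₀(ℝ²)` with a directional derivative of a test function `g`
vanishes, then so does the convolution of `φ` with `g`. -/
theorem conv_eq_zero_of_lineDeriv (φ : C₀(ℝ × ℝ, ℝ)) (g : TestFn) (v : ℝ × ℝ) (hv : v ≠ 0)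
    (h : ∀ x, ∫ t, φ t * (∂_{v} g) (x - t) = 0) (x : ℝ × ℝ) :
    ∫ t, φ t * g (x - t) = 0 := by
  have hloc : LocallyIntegrable φ (volume : Measure (ℝ × ℝ)) := φ.continuous.locallyIntegrable
  have hg1 : ContDiff ℝ 1 g := g.contDiff.of_le (by simp)
  set F : ℝ × ℝ → ℝ := fun x => ∫ t, φ t * g (x - t) with hF
  have hd : ∀ x, HasFDerivAt F ((convolution φ (fderiv ℝ g)
      ((ContinuousLinearMap.mul ℝ ℝ).precompR (ℝ × ℝ)) volume) x) x := fun x =>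
    g.hasCompactSupport.hasFDerivAt_convolution_right (ContinuousLinearMap.mul ℝ ℝ) hloc hg1 x
  have hd0 : ∀ x, (convolution φ (fderiv ℝ g)
      ((ContinuousLinearMap.mul ℝ ℝ).precompR (ℝ × ℝ)) volume) x v = 0 := by
    intro x
    rw [convolution_precompR_apply _ hloc (g.hasCompactSupport.fderiv ℝ)
      (hg1.continuous_fderiv one_ne_zero), ← h x]
    refine integral_congr_ae (Eventually.of_forall fun t => ?_)
    simp [lineDeriv_testFn]
  have hline : ∀ s : ℝ, HasDerivAt (fun s : ℝ => F (x + s • v)) 0 s := by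
    intro s
    have h1 : HasDerivAt (fun s : ℝ => x + s • v) v s := by
      simpa using ((hasDerivAt_id s).smul_const v).const_add x
    have h2 := (hd (x + s • v)).comp_hasDerivAt s h1
    rwa [hd0] at h2
  have hconst : ∀ s : ℝ, F (x + s • v) = F x := by
    intro s
    have := is_const_of_deriv_eq_zero (fun s => (hline s).differentiableAt)
      (fun s => (hline s).deriv) s 0
    simpa using this
  have hlim : Tendsto (fun s : ℝ => F (x + s • v)) atTop (𝓝 0) := by
    have hflip : ∀ y, F y = ∫ t, φ (y - t) * g t := by
      intro y
      simp only [hF]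
      rw [← integral_sub_left_eq_self (fun t => φ t * g (y - t)) volume y]
      simp
    simp only [hflip]
    rw [← integral_zero (ℝ × ℝ) ℝ (μ := volume)]
    refine tendsto_integral_filter_of_dominated_convergence (fun t => ‖φ‖ * ‖g t‖) ?_ ?_ ?_ ?_
    · refine Eventually.of_forall fun s => Continuous.aestronglyMeasurable ?_
      have := g.continuous
      have := φ.continuous
      fun_prop
    · refine Eventually.of_forall fun s => Eventually.of_forall fun t => ?_
      rw [norm_mul]
      exact mul_le_mul_of_nonneg_right (φ.toBCF.norm_coe_le_norm _) (norm_nonneg _)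
    · exact ((g.continuous.integrable_of_hasCompactSupport g.hasCompactSupport).norm).const_mul _
    · refine Eventually.of_forall fun t => ?_
      have h1 : Tendsto (fun s : ℝ => x + s • v - t) atTop (cocompact (ℝ × ℝ)) := by
        rw [← Metric.cobounded_eq_cocompact, ← comap_norm_atTop, tendsto_comap_iff]
        have h2 : Tendsto (fun s : ℝ => ‖v‖ * s - ‖x - t‖) atTop atTop :=
          tendsto_atTop_add_const_right _ _ (tendsto_id.const_mul_atTop (norm_pos_iff.2 hv))
        refine tendsto_atTop_mono' _ ?_ h2
        filter_upwards [eventually_ge_atTop (0 : ℝ)] with s hs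
        have h3 : ‖s • v‖ = ‖v‖ * s := by
          rw [norm_smul, Real.norm_of_nonneg hs, mul_comm]
        have h4 : s • v = (x + s • v - t) - (x - t) := by abel
        have h5 := norm_sub_le (x + s • v - t) (x - t)
        rw [← h4, h3] at h5
        simp only [Function.comp_apply]
        linarith
      simpa using ((zero_at_infty φ).comp h1).mul_const (g t)
  simp only [hconst] at hlim
  exact tendsto_nhds_unique tendsto_const_nhds hlim

/-- A function in `C₀(ℝ²)` is determined by its mixed derivative. -/
theorem DD_C0toDistr_injective : Function.Injective (DD ∘ₗ C0toDistr) := by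
  rw [← LinearMap.ker_eq_bot, LinearMap.ker_eq_bot']
  intro φ hφ
  have h1 : ∀ (g : TestFn) (x : ℝ × ℝ),
      ∫ t, φ t * (∂_{((0, 1) : ℝ × ℝ)} (∂_{((1, 0) : ℝ × ℝ)} g)) (x - t) = 0 := by
    intro g x
    have h2 : DD (C0toDistr φ) (reflect g x) = 0 := by
      change (DD ∘ₗ C0toDistr) φ (reflect g x) = 0
      rw [hφ]; rfl
    rw [DD_apply, lineDeriv_reflect, LineDeriv.lineDerivOp_neg, lineDeriv_reflect, neg_neg,
      C0toDistr_apply] at h2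
    refine Eq.trans (integral_congr_ae (Eventually.of_forall fun t => ?_)) h2
    exact mul_comm _ _
  have h2 : ∀ (g : TestFn) (x : ℝ × ℝ), ∫ t, φ t * g (x - t) = 0 := fun g =>
    conv_eq_zero_of_lineDeriv φ g (1, 0) (by simp)
      (conv_eq_zero_of_lineDeriv φ _ (0, 1) (by simp) (h1 g))
  have h3 : ∀ᵐ x, φ x = 0 := by
    refine ae_eq_zero_of_integral_contDiff_smul_eq_zero φ.continuous.locallyIntegrable ?_
    intro g hg hgc
    have h4 := h2 (reflect ⟨g, hg, hgc, fun _ _ => trivial⟩ 0) 0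
    refine Eq.trans (integral_congr_ae (Eventually.of_forall fun t => ?_)) h4
    simp only [reflect_apply, zero_sub, smul_eq_mul, sub_neg_eq_add, zero_add]
    exact mul_comm _ _
  have h4 : (φ : ℝ × ℝ → ℝ) = 0 := (φ.continuous.ae_eq_iff_eq volume continuous_zero).1 h3
  ext x
  exact congrFun h4 x

/-- The vector space `[D ⊗ D]{C₀(ℝ²)}` of distributions. -/
def MixedDerivC0 : Type := LinearMap.range (DD ∘ₗ C0toDistr)

namespace MixedDerivC0

instance : AddCommGroup MixedDerivC0 :=
  inferInstanceAs (AddCommGroup (LinearMap.range (DD ∘ₗ C0toDistr)))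

instance : Module ℝ MixedDerivC0 :=
  inferInstanceAs (Module ℝ (LinearMap.range (DD ∘ₗ C0toDistr)))

/-- The map `φ ↦ [D ⊗ D] φ`, a linear bijection from `C₀(ℝ²)` onto `[D ⊗ D]{C₀(ℝ²)}`. -/
def ofC0 : C₀(ℝ × ℝ, ℝ) ≃ₗ[ℝ] MixedDerivC0 :=
  LinearEquiv.ofInjective (DD ∘ₗ C0toDistr) DD_C0toDistr_injective

/-- The norm `‖[D ⊗ D] φ‖ = ‖φ‖_∞`. -/
instance : NormedAddCommGroup MixedDerivC0 :=
  NormedAddCommGroup.induced MixedDerivC0 C₀(ℝ × ℝ, ℝ) ofC0.symm ofC0.symm.injective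

theorem norm_ofC0 (φ : C₀(ℝ × ℝ, ℝ)) : ‖ofC0 φ‖ = ‖φ‖ := by
  change ‖ofC0.symm (ofC0 φ)‖ = ‖φ‖
  rw [LinearEquiv.symm_apply_apply]

instance : NormedSpace ℝ MixedDerivC0 where
  norm_smul_le c v := by
    change ‖ofC0.symm (c • v)‖ ≤ ‖c‖ * ‖ofC0.symm v‖
    rw [map_smul, norm_smul]

end MixedDerivC0

/-! ### Duality -/

/-- The bracket `⟨f, [D ⊗ D] φ⟩ = ⟨[D ⊗ D] f, φ⟩ = ∫ φ dm`, where `m` is the measure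
`[D ⊗ D] f`. For a test function `φ` it is the value of the distribution `f` at the test
function `[D ⊗ D] φ`, see `bracket_eq_apply`. -/
def bracket (f : nativeSpace) (v : MixedDerivC0) : ℝ :=
  ∫ᵛ x, MixedDerivC0.ofC0.symm v x ∂•(measureOf (DD f))

theorem isRepresentedBy_measureOf (f : nativeSpace) :
    IsRepresentedBy (DD f) (measureOf (DD f)) := by
  unfold measureOf
  rw [dif_pos f.2.1]
  exact f.2.1.choose_spec.2

theorem bracket_eq_apply (f : nativeSpace) (φ : C₀(ℝ × ℝ, ℝ)) (ψ : TestFn)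
    (h : ∀ x, φ x = ψ x) :
    bracket f (MixedDerivC0.ofC0 φ) =
      (f : Distr) (∂_{((0, 1) : ℝ × ℝ)} (∂_{((1, 0) : ℝ × ℝ)} ψ)) := by
  rw [← DD_apply, isRepresentedBy_measureOf f ψ, bracket, LinearEquiv.symm_apply_apply]
  simp only [h]

/-- `M₀`: the elements of `[D ⊗ D]{C₀(ℝ²)}` that are annihilated by the native space. -/
def M0 : Submodule ℝ MixedDerivC0 where
  carrier := {v | ∀ f : nativeSpace, bracket f v = 0}
  zero_mem' f := by simp [bracket]
  add_mem' := by
    intro v w hv hw f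
    have h := VectorMeasure.integral_add (B := ContinuousLinearMap.lsmul ℝ ℝ)
      (integrable_C0 (measureOf (DD f)) (MixedDerivC0.ofC0.symm v))
      (integrable_C0 (measureOf (DD f)) (MixedDerivC0.ofC0.symm w))
    have hv' := hv f
    have hw' := hw f
    unfold bracket at *
    rw [map_add, ZeroAtInftyContinuousMap.coe_add, h, hv', hw', add_zero]
  smul_mem' := by
    intro c v hv f
    have hv' := hv f
    unfold bracket at *
    rw [map_smul, ZeroAtInftyContinuousMap.coe_smul, VectorMeasure.integral_smul, hv', smul_zero]

end MixedTV

end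

open MixedTV

noncomputable section

namespace MixedTV

/-! ### Signed measures and their integrals -/

section SignedMeasure

variable {X : Type*} [MeasurableSpace X]

/-! The native space is a concrete space of measures. If `f` vanishes off `K` and `m = DD f`, then
`m` integrates a smooth `G` with `∂₁∂₂G = 0` to zero: cut off near `K`, its mixed derivative still
vanishes where `f` can see it (`DD_localize_eq_zero`). Taking for `G` functions of one variable
shows that both marginals of `m` vanish.

Conversely, let `m` in `M(K)` have zero marginals, and let `S₁`, `S₂` denote integration in one
variable up to `1`. Then `f ψ = ∫ S₁S₂ψ dm` defines a distribution vanishing off `K`, and `DD f = m`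
because `S₁S₂∂₂∂₁ψ` differs from `ψ` by a sum of functions of one variable (`DD_distrOfMeasure`). It
is the only one: near `K` every test function is the mixed derivative of a test function
(`eq_zero_of_DD_eq_zero`).

With this formula `ID f` is `ψ ↦ ∫ S₁ψ dm` and `DI f` is `ψ ↦ ∫ S₂ψ dm`. Both `S₁` and `S₂` are
contractions for the sup norm on `K`, so by the Riesz theorem (`exists_integralC0_eq`) both
derivatives are measures in `M(K)` of norm at most `‖m‖`. Hence `θ‖DD f‖ ≤ ‖f‖_θ ≤ 2‖DD f‖`, which
gives the norm property and the equivalence.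

For the duality, a functional on the quotient pulls back to `C₀` and is integration against some
`m`. Since `M0` contains the test functions supported off `K` and the localized `G` with `∂₁∂₂G =
0`, this `m` lies in `M(K)` and has zero marginals, so it comes from the native space
(`toDual_surjective`). Completeness of the dual then passes to every `‖·‖_θ`. -/

instance isFiniteMeasure_variation_signedMeasure (m : SignedMeasure X) :
    IsFiniteMeasure m.variation := by
  rw [← SignedMeasure.totalVariation_eq_variation, SignedMeasure.totalVariation]
  infer_instance

theorem integral_toSignedMeasure_real (μ : Measure X) [IsFiniteMeasure μ] (g : X → ℝ) :
    ∫ᵛ x, g x ∂•μ.toSignedMeasure = ∫ x, g x ∂μ := by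
  have h : (ContinuousLinearMap.lsmul ℝ ℝ : ℝ →L[ℝ] ℝ →L[ℝ] ℝ) =
      (ContinuousLinearMap.lsmul ℝ ℝ).flip := by
    ext; simp
  rw [h, VectorMeasure.integral_toSignedMeasure]

/-- The polar decomposition of a signed measure. -/
theorem exists_sign (m : SignedMeasure X) : ∃ h : X → ℝ, Measurable h ∧ (∀ x, |h x| = 1) ∧
    ∀ g : X → ℝ, m.Integrable g → ∫ᵛ x, g x ∂•m = ∫ x, g x * h x ∂m.variation := by
  classical
  set μ := m.toJordanDecomposition.posPart with hμ
  set ν := m.toJordanDecomposition.negPart with hν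
  have hvar : m.variation = μ + ν := by
    rw [← SignedMeasure.totalVariation_eq_variation, SignedMeasure.totalVariation]
  obtain ⟨s, hs, hs1, hs2⟩ := m.toJordanDecomposition.mutuallySingular
  -- The positive part has no mass on `s` and the negative part none off `s`.
  refine ⟨s.piecewise (fun _ => -1) (fun _ => 1), by fun_prop (disch := assumption), ?_, ?_⟩
  · intro x
    by_cases hx : x ∈ s <;> simp [hx]
  · intro g hg
    have hg' : Integrable g (μ + ν) := by rw [← hvar]; exact hg
    rw [integrable_add_measure] at hg'
    have h1 : ∫ᵛ x, g x ∂•m = ∫ x, g x ∂μ - ∫ x, g x ∂ν := by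
      conv_lhs => rw [← m.toSignedMeasure_toJordanDecomposition,
        JordanDecomposition.toSignedMeasure]
      rw [VectorMeasure.integral_sub_vectorMeasure, integral_toSignedMeasure_real,
        integral_toSignedMeasure_real]
      · simpa [VectorMeasure.Integrable] using hg'.1
      · simpa [VectorMeasure.Integrable] using hg'.2
    have hp : (fun x => g x * s.piecewise (fun _ => (-1 : ℝ)) (fun _ => 1) x) =ᵐ[μ] g := by
      filter_upwards [measure_eq_zero_iff_ae_notMem.1 hs1] with x hx
      simp [hx]
    have hn : (fun x => g x * s.piecewise (fun _ => (-1 : ℝ)) (fun _ => 1) x) =ᵐ[ν] -g := by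
      filter_upwards [measure_eq_zero_iff_ae_notMem.1 hs2] with x hx
      have : x ∈ s := by simpa using hx
      simp [this]
    rw [h1, hvar, integral_add_measure (hg'.1.congr hp.symm) (hg'.2.neg.congr hn.symm),
      integral_congr_ae hp, integral_congr_ae hn, sub_eq_add_neg, ← integral_neg]
    rfl

theorem abs_integral_le (m : SignedMeasure X) {g : X → ℝ} {C : ℝ}
    (h : ∀ᵐ x ∂m.variation, |g x| ≤ C) :
    |∫ᵛ x, g x ∂•m| ≤ C * (m.variation univ).toReal := by
  refine (VectorMeasure.norm_integral_le_of_norm_le_const (B := ContinuousLinearMap.lsmul ℝ ℝ)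
    (f := g) h).trans (le_of_eq ?_)
  simp [Measure.real]

theorem toReal_variation_univ_eq_zero {m : SignedMeasure X} :
    (m.variation univ).toReal = 0 ↔ m = 0 := by
  rw [ENNReal.toReal_eq_zero_iff, or_iff_left (measure_ne_top _ _),
    VectorMeasure.variation_apply_eq_zero MeasurableSet.univ]
  constructor
  · intro h
    ext s hs
    simpa using h s (subset_univ s) hs
  · rintro rfl
    simp

end SignedMeasure

/-- A signed measure that annihilates all smooth functions with compact support in an open set
has no mass there. -/
theorem variation_eq_zero_of_integral_contDiff {E : Type*} [NormedAddCommGroup E]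
    [NormedSpace ℝ E] [FiniteDimensional ℝ E] [MeasurableSpace E] [BorelSpace E]
    (m : SignedMeasure E) {U : Set E} (hU : IsOpen U)
    (h : ∀ g : E → ℝ, ContDiff ℝ (⊤ : ℕ∞) g → HasCompactSupport g → tsupport g ⊆ U →
      ∫ᵛ x, g x ∂•m = 0) : m.variation U = 0 := by
  obtain ⟨s, hs, hs1, hint⟩ := exists_sign m
  have hsi : Integrable s m.variation :=
    Integrable.of_bound hs.aestronglyMeasurable 1 (Eventually.of_forall fun x => (hs1 x).le)
  -- The sign `s` is a locally integrable density that annihilates the test functions in `U`, so it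
  -- vanishes a.e. there; as `|s| = 1`, this leaves no mass in `U`.
  have h0 := hU.ae_eq_zero_of_integral_contDiff_smul_eq_zero
    (hsi.locallyIntegrable.locallyIntegrableOn U) (fun g hg hgc hgU => by
      rw [← h g hg hgc hgU, hint g (hg.continuous.integrable_of_hasCompactSupport hgc)]
      rfl)
  rw [measure_eq_zero_iff_ae_notMem]
  filter_upwards [h0] with x hx hxU
  have := hs1 x
  simp [hx hxU] at this

theorem eq_zero_of_integral_contDiff {E : Type*} [NormedAddCommGroup E]
    [NormedSpace ℝ E] [FiniteDimensional ℝ E] [MeasurableSpace E] [BorelSpace E]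
    (m : SignedMeasure E)
    (h : ∀ g : E → ℝ, ContDiff ℝ (⊤ : ℕ∞) g → HasCompactSupport g → ∫ᵛ x, g x ∂•m = 0) :
    m = 0 := by
  rw [← toReal_variation_univ_eq_zero, variation_eq_zero_of_integral_contDiff m isOpen_univ
    (fun g hg hgc _ => h g hg hgc), ENNReal.toReal_zero]

/-- Makes the choice inside `measureOf` immaterial. -/
theorem IsRepresentedBy.unique {T : Distr} {m n : SignedMeasure (ℝ × ℝ)}
    (hm : IsRepresentedBy T m) (hn : IsRepresentedBy T n) : m = n := by
  rw [← sub_eq_zero]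
  refine eq_zero_of_integral_contDiff _ fun g hg hgc => ?_
  set ψ : TestFn := ⟨g, hg, hgc, fun _ _ => trivial⟩
  have h := VectorMeasure.integral_sub_vectorMeasure (B := ContinuousLinearMap.lsmul ℝ ℝ)
    (integrable_testFn m ψ) (integrable_testFn n ψ)
  rw [← hm, ← hn, sub_self] at h
  exact h

/-- The total variation norm is the norm as a functional on `C₀(ℝ²)`. -/
theorem tvNorm_le_of_forall_C0 (m : SignedMeasure (ℝ × ℝ)) {C : ℝ} (hC : 0 ≤ C)
    (h : ∀ φ : C₀(ℝ × ℝ, ℝ), |∫ᵛ x, φ x ∂•m| ≤ C * ‖φ‖) : tvNorm m ≤ C := by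
  obtain ⟨s, hs, hs1, hint⟩ := exists_sign m
  have hsi : Integrable s m.variation :=
    Integrable.of_bound hs.aestronglyMeasurable 1 (Eventually.of_forall fun x => (hs1 x).le)
  refine le_of_forall_pos_le_add fun ε hε => ?_
  -- Approximate the sign in `L¹` of the variation, then clamp to `[-1, 1]` so that the competitor
  -- has norm at most one.
  obtain ⟨g, hgc, hgle, hg, hgi⟩ := hsi.exists_hasCompactSupport_integral_sub_le hε
  set g' : ℝ × ℝ → ℝ := fun x => max (-1) (min 1 (g x)) with hg'
  have hg'c : HasCompactSupport g' := by
    refine hgc.mono fun x hx => ?_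
    contrapose! hx
    simp only [Function.mem_support, not_not] at hx
    simp [hg', hx]
  have hcont : Continuous g' := by fun_prop
  set φ : C₀(ℝ × ℝ, ℝ) :=
    ⟨⟨g', hcont⟩, hg'c.is_zero_at_infty⟩
  have hφ : ‖φ‖ ≤ 1 := by
    rw [← ZeroAtInftyContinuousMap.norm_toBCF_eq_norm,
      BoundedContinuousFunction.norm_le zero_le_one]
    intro x
    change |g' x| ≤ 1
    rw [abs_le]
    exact ⟨le_max_left _ _, max_le (by norm_num) (min_le_left _ _)⟩
  have h1 : ∫ᵛ x, φ x ∂•m = ∫ x, g' x * s x ∂m.variation := hint _ (integrable_C0 m φ)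
  have hgi' : Integrable g' m.variation := integrable_C0 m φ
  -- Clamping does not increase the distance to `s = ±1`, whence `1 ≤ g' s + |s - g|` pointwise.
  have h2 : tvNorm m ≤ ∫ x, (g' x * s x + |s x - g x|) ∂m.variation := by
    have : tvNorm m = ∫ x, (1 : ℝ) ∂m.variation := by simp [tvNorm, Measure.real]
    rw [this]
    refine integral_mono (integrable_const _) ?_ fun x => ?_
    · refine Integrable.add ?_ (hsi.sub hgi).abs
      exact hgi'.mul_bdd (c := 1) hs.aestronglyMeasurable
        (Eventually.of_forall fun x => (hs1 x).le)
    · simp only [hg']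
      rcases eq_or_eq_neg_of_abs_eq (hs1 x) with h | h <;> rw [h]
      · rcases le_total 1 (g x) with h1 | h1
        · simp [h1]
        · rw [min_eq_right h1, abs_of_nonneg (by linarith)]
          have := le_max_right (-1) (g x)
          linarith
      · rcases le_total (g x) (-1) with h1 | h1
        · rw [min_eq_right (by linarith), max_eq_left h1]
          have := abs_nonneg (-1 - g x)
          linarith
        · have h2 : max (-1) (min 1 (g x)) ≤ g x := max_le h1 (min_le_right _ _)
          have := neg_abs_le (-1 - g x)
          linarith
  rw [integral_add (f := fun x => g' x * s x) (g := fun x => |s x - g x|) (hgi'.mul_bdd (c := 1) hs.aestronglyMeasurable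
    (Eventually.of_forall fun x => (hs1 x).le)) (hsi.sub hgi).abs, ← h1] at h2
  have h3 := (le_abs_self _).trans (h φ)
  have h4 : ∫ x, |s x - g x| ∂m.variation ≤ ε := hgle
  nlinarith [norm_nonneg φ]

/-! ### The Riesz representation theorem for bounded functionals on `C₀` -/

section Riesz

open scoped NNReal CompactlySupported
open CompactlySupportedContinuousMap

variable {X : Type*} [TopologicalSpace X]

/-- A nonnegative function with compact support as an element of `C₀`. -/
def nnToC0 : C_c(X, ℝ≥0) →ₗ[ℝ≥0] C₀(X, ℝ) where
  toFun f := ⟨⟨fun x => (f x : ℝ), by fun_prop⟩,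
    (f.hasCompactSupport.comp_left (g := fun r : ℝ≥0 => (r : ℝ)) rfl).is_zero_at_infty⟩
  map_add' f g := by ext; simp
  map_smul' c f := by ext; simp [NNReal.smul_def]

@[simp]
theorem nnToC0_apply (f : C_c(X, ℝ≥0)) (x : X) : nnToC0 f x = f x := rfl

theorem norm_C0_le {φ : C₀(X, ℝ)} {C : ℝ} (hC : 0 ≤ C) (h : ∀ x, |φ x| ≤ C) : ‖φ‖ ≤ C := by
  rw [← ZeroAtInftyContinuousMap.norm_toBCF_eq_norm, BoundedContinuousFunction.norm_le hC]
  exact h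

theorem abs_C0_le (φ : C₀(X, ℝ)) (x : X) : |φ x| ≤ ‖φ‖ := φ.toBCF.norm_coe_le_norm x

theorem norm_nnToC0_mono {f g : C_c(X, ℝ≥0)} (h : f ≤ g) : ‖nnToC0 f‖ ≤ ‖nnToC0 g‖ := by
  refine norm_C0_le (norm_nonneg _) fun x => ?_
  refine le_trans ?_ (abs_C0_le (nnToC0 g) x)
  simpa using h x

theorem norm_nnToC0_le_one {f : C_c(X, ℝ≥0)} (hf : ∀ x, f x ≤ 1) : ‖nnToC0 f‖ ≤ 1 :=
  norm_C0_le zero_le_one fun x => by simpa using hf x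

/-- Functions with compact support are dense in `C₀`. -/
theorem exists_nnToC0_near (φ : C₀(X, ℝ)) {ε : ℝ} (hε : 0 < ε) :
    ∃ f g : C_c(X, ℝ≥0), ‖φ - (nnToC0 f - nnToC0 g)‖ ≤ ε := by
  have hcpt : ∀ s : ℝ → ℝ, Continuous s → (∀ t, |t| < ε → s t = 0) →
      HasCompactSupport (fun x => s (φ x)) := by
    intro s hs hs0
    have h1 : {x | |φ x| < ε} ∈ cocompact X := by
      have := (zero_at_infty φ).eventually (Metric.ball_mem_nhds (0 : ℝ) hε)
      filter_upwards [this] with x hx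
      simpa using hx
    obtain ⟨k, hk, hkc⟩ := mem_cocompact.1 h1
    have h2 : Function.support (fun x => s (φ x)) ⊆ {x | ε ≤ |φ x|} := by
      intro x hx
      by_contra! h
      exact hx (hs0 _ (by simpa using h))
    have h3 : IsClosed {x | ε ≤ |φ x|} :=
      isClosed_le continuous_const φ.continuous.abs
    refine hk.of_isClosed_subset isClosed_closure ((closure_minimal h2 h3).trans ?_)
    intro x hx
    by_contra hxk
    exact absurd (mem_ofPred.1 (hkc hxk)) (not_lt.2 hx)
  -- Soft thresholding: `(φ - ε)⁺ - (-φ - ε)⁺` is within `ε` of `φ`, and both terms are zero where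
  -- `|φ| < ε`.
  refine ⟨nnrealPart ⟨⟨fun x => max 0 (φ x - ε), by fun_prop⟩,
      hcpt (fun t => max 0 (t - ε)) (by fun_prop) fun t ht => ?_⟩,
    nnrealPart ⟨⟨fun x => max 0 (- φ x - ε), by fun_prop⟩,
      hcpt (fun t => max 0 (-t - ε)) (by fun_prop) fun t ht => ?_⟩,
    norm_C0_le hε.le fun x => ?_⟩
  · rw [abs_lt] at ht
    exact max_eq_left (by linarith)
  · rw [abs_lt] at ht
    exact max_eq_left (by linarith)
  · simp only [ZeroAtInftyContinuousMap.coe_sub, Pi.sub_apply, nnToC0_apply, nnrealPart_apply,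
      coe_mk, ContinuousMap.coe_mk]
    rw [Real.coe_toNNReal _ (le_max_left _ _), Real.coe_toNNReal _ (le_max_left _ _), abs_le]
    rcases max_cases 0 (φ x - ε) with h | h <;> rcases max_cases 0 (-φ x - ε) with h' | h' <;>
      constructor <;> linarith

variable (L : C₀(X, ℝ) →L[ℝ] ℝ)

/-- The positive part of a bounded functional, on nonnegative functions. -/
def posVal (f : C_c(X, ℝ≥0)) : ℝ := sSup ((fun g => L (nnToC0 g)) '' Iic f)

theorem apply_le_norm_of_le {f g : C_c(X, ℝ≥0)} (h : g ≤ f) :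
    L (nnToC0 g) ≤ ‖L‖ * ‖nnToC0 f‖ :=
  (le_abs_self _).trans ((L.le_opNorm _).trans
    (mul_le_mul_of_nonneg_left (norm_nnToC0_mono h) (norm_nonneg _)))

theorem le_posVal {f g : C_c(X, ℝ≥0)} (h : g ≤ f) : L (nnToC0 g) ≤ posVal L f := by
  refine le_csSup ⟨‖L‖ * ‖nnToC0 f‖, ?_⟩ ⟨g, h, rfl⟩
  rintro _ ⟨g', hg', rfl⟩
  exact apply_le_norm_of_le L hg'

theorem posVal_le {f : C_c(X, ℝ≥0)} {c : ℝ} (h : ∀ g ≤ f, L (nnToC0 g) ≤ c) :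
    posVal L f ≤ c := by
  refine csSup_le ⟨_, f, le_refl f, rfl⟩ ?_
  rintro _ ⟨g, hg, rfl⟩
  exact h g hg

theorem zero_le_Cc (f : C_c(X, ℝ≥0)) : 0 ≤ f := fun _ => zero_le

theorem posVal_nonneg (f : C_c(X, ℝ≥0)) : 0 ≤ posVal L f := by
  have h := le_posVal L (zero_le_Cc f)
  rwa [map_zero, map_zero] at h

theorem posVal_le_norm (f : C_c(X, ℝ≥0)) : posVal L f ≤ ‖L‖ * ‖nnToC0 f‖ :=
  posVal_le L fun _ hg => apply_le_norm_of_le L hg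

/-- Riesz decomposition: any `g ≤ f₁ + f₂` splits into `g ⊓ f₁` and a remainder below `f₂`. For the
other inequality the two suprema are taken one after the other. -/
theorem posVal_add (f₁ f₂ : C_c(X, ℝ≥0)) :
    posVal L (f₁ + f₂) = posVal L f₁ + posVal L f₂ := by
  apply le_antisymm
  · refine posVal_le L fun g hg => ?_
    obtain ⟨g₂, hg₂⟩ := CompactlySupportedContinuousMap.exists_add_of_le
      (inf_le_left : g ⊓ f₁ ≤ g)
    have h2 : g₂ ≤ f₂ := by
      intro x
      have h3 := DFunLike.congr_fun hg₂ x
      have h4 : g x ≤ f₁ x + f₂ x := hg x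
      have h5 : min (g x) (f₁ x) + g₂ x = g x := h3
      change g₂ x ≤ f₂ x
      rcases le_total (g x) (f₁ x) with h | h
      · rw [min_eq_left h, add_eq_left] at h5
        rw [h5]; exact zero_le
      · rw [min_eq_right h] at h5
        rw [← h5] at h4
        exact le_of_add_le_add_left h4
    rw [← hg₂, map_add, map_add]
    exact add_le_add (le_posVal L inf_le_right) (le_posVal L h2)
  · rw [← le_sub_iff_add_le]
    refine posVal_le L fun g₁ hg₁ => ?_
    rw [le_sub_comm]
    refine posVal_le L fun g₂ hg₂ => ?_
    rw [le_sub_iff_add_le, add_comm, ← map_add, ← map_add]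
    exact le_posVal L (add_le_add hg₁ hg₂)

theorem map_nn_smul (c : ℝ≥0) (φ : C₀(X, ℝ)) : L (c • φ) = c * L φ := L.map_smul (c : ℝ) φ

theorem posVal_smul_le {c : ℝ≥0} (hc : c ≠ 0) (f : C_c(X, ℝ≥0)) :
    posVal L (c • f) ≤ c * posVal L f := by
  refine posVal_le L fun g hg => ?_
  have h : c⁻¹ • g ≤ f := by
    intro x
    have h1 : g x ≤ c * f x := hg x
    change c⁻¹ * g x ≤ f x
    rwa [inv_mul_le_iff₀ (pos_iff_ne_zero.2 hc)]
  have h2 : L (nnToC0 g) = c * L (nnToC0 (c⁻¹ • g)) := by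
    rw [← map_nn_smul, ← map_smul, smul_inv_smul₀ hc]
  rw [h2]
  exact mul_le_mul_of_nonneg_left (le_posVal L h) c.2

/-- For `c ≠ 0` the missing inequality is `posVal_smul_le` applied to `c⁻¹`; for `c = 0` the norm
bound suffices. -/
theorem posVal_smul (c : ℝ≥0) (f : C_c(X, ℝ≥0)) : posVal L (c • f) = c * posVal L f := by
  rcases eq_or_ne c 0 with rfl | hc
  · refine le_antisymm ?_ (by simpa using posVal_nonneg L _)
    refine (posVal_le_norm L _).trans ?_
    simp
  · refine le_antisymm (posVal_smul_le L hc f) ?_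
    have h := posVal_smul_le L (inv_ne_zero hc) (c • f)
    rw [inv_smul_smul₀ hc, NNReal.coe_inv] at h
    rwa [← le_inv_mul_iff₀ (by positivity)]

/-- The positive part of a bounded functional. -/
def posPartFunctional : C_c(X, ℝ≥0) →ₗ[ℝ≥0] ℝ≥0 where
  toFun f := ⟨posVal L f, posVal_nonneg L f⟩
  map_add' f g := NNReal.eq (posVal_add L f g)
  map_smul' c f := NNReal.eq (posVal_smul L c f)

/-- The negative part of a bounded functional. -/
def negPartFunctional : C_c(X, ℝ≥0) →ₗ[ℝ≥0] ℝ≥0 where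
  toFun f := ⟨posVal L f - L (nnToC0 f), sub_nonneg.2 (le_posVal L le_rfl)⟩
  map_add' f g := by
    refine NNReal.eq ?_
    change posVal L (f + g) - L (nnToC0 (f + g)) =
      (posVal L f - L (nnToC0 f)) + (posVal L g - L (nnToC0 g))
    rw [posVal_add, map_add, map_add]
    ring
  map_smul' c f := by
    refine NNReal.eq ?_
    change posVal L (c • f) - L (nnToC0 (c • f)) = c * (posVal L f - L (nnToC0 f))
    rw [posVal_smul, map_smul, map_nn_smul]
    ring

variable [T2Space X] [LocallyCompactSpace X] [MeasurableSpace X] [BorelSpace X]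

/-- By inner regularity it is enough to bound the mass of compact sets, and a Urysohn function
dominates the indicator of each. -/
theorem isFiniteMeasure_rieszMeasure (Λ : C_c(X, ℝ≥0) →ₗ[ℝ≥0] ℝ≥0) (C : ℝ≥0)
    (h : ∀ f, (∀ x, f x ≤ 1) → Λ f ≤ C) : IsFiniteMeasure (NNRealRMK.rieszMeasure Λ) := by
  refine ⟨lt_of_le_of_lt ?_ (ENNReal.coe_lt_top (r := C))⟩
  rw [isOpen_univ.measure_eq_iSup_isCompact]
  refine iSup₂_le fun k _ => iSup_le fun hk => ?_
  obtain ⟨f, hf1, hf2, -, hf3⟩ := exists_continuousMap_one_of_isCompact_subset_isOpen hk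
    isOpen_univ (subset_univ k)
  set g : C_c(X, ℝ≥0) := nnrealPart ⟨f, hf2⟩ with hg
  have hgx : ∀ x, g x = (f x).toNNReal := fun x => rfl
  calc NNRealRMK.rieszMeasure Λ k = ∫⁻ x in k, 1 ∂(NNRealRMK.rieszMeasure Λ) := by simp
    _ = ∫⁻ x in k, g x ∂(NNRealRMK.rieszMeasure Λ) := by
      refine setLIntegral_congr_fun hk.measurableSet fun x hx => ?_
      simp [hgx, hf1 hx]
    _ ≤ ∫⁻ x, g x ∂(NNRealRMK.rieszMeasure Λ) := setLIntegral_le_lintegral _ _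
    _ = Λ g := NNRealRMK.lintegral_rieszMeasure Λ g
    _ ≤ C := by
      refine ENNReal.coe_le_coe.2 (h g fun x => ?_)
      rw [hgx, Real.toNNReal_le_one]
      exact (hf3 x).2

instance isFiniteMeasure_riesz_posPart :
    IsFiniteMeasure (NNRealRMK.rieszMeasure (posPartFunctional L)) := by
  refine isFiniteMeasure_rieszMeasure _ ‖L‖₊ fun f hf => ?_
  change posVal L f ≤ ‖L‖
  exact (posVal_le_norm L f).trans
    (mul_le_of_le_one_right L.opNorm_nonneg (norm_nnToC0_le_one hf))

instance isFiniteMeasure_riesz_negPart :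
    IsFiniteMeasure (NNRealRMK.rieszMeasure (negPartFunctional L)) := by
  refine isFiniteMeasure_rieszMeasure _ (‖L‖₊ + ‖L‖₊) fun f hf => ?_
  change posVal L f - L (nnToC0 f) ≤ ‖L‖ + ‖L‖
  have h1 := (posVal_le_norm L f).trans
    (mul_le_of_le_one_right L.opNorm_nonneg (norm_nnToC0_le_one hf))
  have h2 := (L.le_opNorm (nnToC0 f)).trans
    (mul_le_of_le_one_right L.opNorm_nonneg (norm_nnToC0_le_one hf))
  have h3 := neg_abs_le (L (nnToC0 f))
  rw [Real.norm_eq_abs] at h2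
  linarith

end Riesz

/-- Integration against a signed measure as a bounded functional on `C₀(ℝ²)`. -/
def integralC0 (m : SignedMeasure (ℝ × ℝ)) : C₀(ℝ × ℝ, ℝ) →L[ℝ] ℝ :=
  LinearMap.mkContinuous
    { toFun := fun φ => ∫ᵛ x, φ x ∂•m
      map_add' := fun φ χ => VectorMeasure.integral_add (integrable_C0 m φ) (integrable_C0 m χ)
      map_smul' := fun c φ => VectorMeasure.integral_smul φ m _ c }
    (tvNorm m) fun φ => by
      rw [mul_comm]
      exact abs_integral_le m (Eventually.of_forall fun x => abs_C0_le φ x)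

theorem integralC0_apply (m : SignedMeasure (ℝ × ℝ)) (φ : C₀(ℝ × ℝ, ℝ)) :
    integralC0 m φ = ∫ᵛ x, φ x ∂•m := rfl

theorem tvNorm_nonneg (m : SignedMeasure (ℝ × ℝ)) : 0 ≤ tvNorm m := ENNReal.toReal_nonneg

theorem norm_integralC0 (m : SignedMeasure (ℝ × ℝ)) : ‖integralC0 m‖ = tvNorm m :=
  le_antisymm (LinearMap.mkContinuous_norm_le _ (tvNorm_nonneg m) _)
    (tvNorm_le_of_forall_C0 m (integralC0 m).opNorm_nonneg fun φ => (integralC0 m).le_opNorm φ)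

/-- Every bounded functional on `C₀(ℝ²)` is the integral against a signed measure. -/
theorem exists_integralC0_eq (L : C₀(ℝ × ℝ, ℝ) →L[ℝ] ℝ) :
    ∃ m : SignedMeasure (ℝ × ℝ), integralC0 m = L := by
  set μ := NNRealRMK.rieszMeasure (posPartFunctional L)
  set ν := NNRealRMK.rieszMeasure (negPartFunctional L)
  refine ⟨μ.toSignedMeasure - ν.toSignedMeasure, ?_⟩
  set M := integralC0 (μ.toSignedMeasure - ν.toSignedMeasure) with hM
  -- The negative part is defined as the positive part minus `L`, so the difference of the two
  -- measures gives back `L` on these functions; density does the rest.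
  have h1 : ∀ f, M (nnToC0 f) = L (nnToC0 f) := by
    intro f
    rw [hM, integralC0_apply,
      VectorMeasure.integral_sub_vectorMeasure (integrable_C0 _ _) (integrable_C0 _ _),
      integral_toSignedMeasure_real, integral_toSignedMeasure_real]
    simp only [nnToC0_apply]
    rw [NNRealRMK.integral_rieszMeasure, NNRealRMK.integral_rieszMeasure]
    change posVal L f - (posVal L f - L (nnToC0 f)) = _
    ring
  ext φ
  rw [← sub_eq_zero]
  change (M - L) φ = 0
  rw [← norm_le_zero_iff]
  refine le_of_forall_pos_le_add fun ε hε => ?_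
  obtain ⟨f, g, hfg⟩ := exists_nnToC0_near φ (ε := ε / (‖M - L‖ + 1)) (by positivity)
  have h2 : (M - L) φ = (M - L) (φ - (nnToC0 f - nnToC0 g)) := by
    simp [h1]
  rw [h2, zero_add]
  refine ((M - L).le_opNorm _).trans ?_
  calc ‖M - L‖ * ‖φ - (nnToC0 f - nnToC0 g)‖
      ≤ (‖M - L‖ + 1) * (ε / (‖M - L‖ + 1)) := by gcongr; linarith
    _ = ε := by field_simp

/-! ### Distributions that vanish outside the square -/

/-- A cutoff function that is `1` near the square. -/
def cutoff : ContDiffBump (0 : ℝ × ℝ) := ⟨2, 3, by norm_num, by norm_num⟩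

theorem K_subset_ball : K ⊆ Metric.ball (0 : ℝ × ℝ) 2 := by
  rintro ⟨x, y⟩ ⟨⟨hx0, hx1⟩, ⟨hy0, hy1⟩⟩
  dsimp only at hx0 hx1 hy0 hy1
  rw [mem_ball_zero_iff, Prod.norm_def]
  simp only [Real.norm_eq_abs]
  rw [abs_of_nonneg hx0, abs_of_nonneg hy0]
  exact max_lt (by linarith) (by linarith)

theorem isClosed_K : IsClosed K := isClosed_Icc.prod isClosed_Icc

theorem isCompact_K : IsCompact K := isCompact_Icc.prod isCompact_Icc

theorem cutoff_eq_one {x : ℝ × ℝ} (hx : x ∈ Metric.ball (0 : ℝ × ℝ) 2) : cutoff x = 1 :=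
  cutoff.one_of_mem_closedBall (Metric.ball_subset_closedBall hx)

/-- A smooth function multiplied with the cutoff function. -/
def localize (G : ℝ × ℝ → ℝ) (hG : ContDiff ℝ (⊤ : ℕ∞) G) : TestFn where
  toFun x := cutoff x * G x
  contDiff' := cutoff.contDiff.mul hG
  hasCompactSupport' := cutoff.hasCompactSupport.mul_right
  tsupport_subset' := fun _ _ => trivial

theorem localize_apply (G : ℝ × ℝ → ℝ) (hG : ContDiff ℝ (⊤ : ℕ∞) G) (x : ℝ × ℝ) :
    localize G hG x = cutoff x * G x := rfl

theorem localize_of_mem {G : ℝ × ℝ → ℝ} {hG : ContDiff ℝ (⊤ : ℕ∞) G} {x : ℝ × ℝ}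
    (hx : x ∈ Metric.ball (0 : ℝ × ℝ) 2) : localize G hG x = G x := by
  rw [localize_apply, cutoff_eq_one hx, one_mul]

theorem lineDeriv_eq_of_eqOn {ψ : TestFn} {G : ℝ × ℝ → ℝ} {U : Set (ℝ × ℝ)} (hU : IsOpen U)
    (h : EqOn ψ G U) (w : ℝ × ℝ) : EqOn (∂_{w} ψ : TestFn) (fun x => fderiv ℝ G x w) U := by
  intro x hx
  rw [lineDeriv_testFn, (h.eventuallyEq_of_mem (hU.mem_nhds hx)).fderiv_eq]

theorem lineDeriv_lineDeriv_localize (G : ℝ × ℝ → ℝ) (hG : ContDiff ℝ (⊤ : ℕ∞) G)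
    (v w : ℝ × ℝ) {x : ℝ × ℝ} (hx : x ∈ Metric.ball (0 : ℝ × ℝ) 2) :
    (∂_{w} (∂_{v} (localize G hG))) x = fderiv ℝ (fun y => fderiv ℝ G y v) x w :=
  lineDeriv_eq_of_eqOn Metric.isOpen_ball
    (lineDeriv_eq_of_eqOn Metric.isOpen_ball (fun _ hy => localize_of_mem hy) v) w hx

/-- A distribution that vanishes outside the square sees only the values near the square. -/
theorem apply_eq_of_eqOn_ball {f : Distr} (hf : Distribution.IsVanishingOn f Kᶜ) {ψ χ : TestFn}
    (h : EqOn ψ χ (Metric.ball (0 : ℝ × ℝ) 2)) : f ψ = f χ := by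
  rw [← sub_eq_zero, ← map_sub]
  refine hf _ fun x hx hxK => ?_
  refine notMem_tsupport_iff_eventuallyEq.2 ?_ hx
  filter_upwards [Metric.isOpen_ball.mem_nhds (K_subset_ball hxK)] with y hy
  simp [h hy]

/-- The source of the marginal conditions: the cutoff is `1` near `K`, so it adds no derivative
terms that `f` could detect. -/
theorem DD_localize_eq_zero {f : Distr} (hf : Distribution.IsVanishingOn f Kᶜ)
    (G : ℝ × ℝ → ℝ) (hG : ContDiff ℝ (⊤ : ℕ∞) G)
    (h : ∀ x, fderiv ℝ (fun y => fderiv ℝ G y (1, 0)) x (0, 1) = 0) :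
    DD f (localize G hG) = 0 := by
  rw [DD_apply]
  refine (apply_eq_of_eqOn_ball hf (χ := 0) fun x hx => ?_).trans (map_zero f)
  rw [lineDeriv_lineDeriv_localize G hG _ _ hx, h]
  rfl

/-- Fundamental theorem of calculus along a ray; `w ≠ 0` keeps the restriction of `g` to the line
compactly supported. -/
theorem integral_Ioi_lineDeriv (g : TestFn) (x w : ℝ × ℝ) (hw : w ≠ 0) :
    ∫ t in Ioi (0 : ℝ), (∂_{w} g) (x - t • w) = g x := by
  have hcs : HasCompactSupport fun t : ℝ => g (x - t • w) :=
    g.hasCompactSupport.comp_isClosedEmbedding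
      ((Homeomorph.subLeft x).isClosedEmbedding.comp (isClosedEmbedding_smul_left hw))
  have hcd : ContDiff ℝ 1 fun t : ℝ => g (x - t • w) :=
    (g.contDiff.of_le (by simp)).comp
      (contDiff_const.sub (contDiff_id.smul contDiff_const))
  have hd : ∀ t : ℝ, HasDerivAt (fun t : ℝ => g (x - t • w)) (-(∂_{w} g) (x - t • w)) t := by
    intro t
    have h1 : HasFDerivAt g (fderiv ℝ g (x - t • w)) (x - t • w) :=
      (g.contDiff.differentiable (by simp) _).hasFDerivAt
    have h2 : HasDerivAt (fun t : ℝ => x - t • w) (-w) t := by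
      simpa using ((hasDerivAt_id t).smul_const w).const_sub x
    have h3 := h1.comp_hasDerivAt t h2
    rw [map_neg, ← lineDeriv_testFn] at h3
    exact h3
  have h := hcs.integral_Ioi_deriv_eq hcd 0
  simp only [(hd _).deriv, integral_neg, zero_smul, sub_zero] at h
  linarith

/-- The indicator function of the closed first quadrant. -/
def quadrant : ℝ × ℝ → ℝ := (Ioi (0 : ℝ) ×ˢ Ioi (0 : ℝ)).indicator 1

theorem locallyIntegrable_quadrant : LocallyIntegrable quadrant (volume : Measure (ℝ × ℝ)) :=
  (locallyIntegrable_const (1 : ℝ)).indicator (measurableSet_Ioi.prod measurableSet_Ioi)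

/-- The convolution of a test function with the indicator function of the first quadrant. -/
def primitive (g : TestFn) (x : ℝ × ℝ) : ℝ := ∫ t, quadrant t * g (x - t)

theorem contDiff_primitive (g : TestFn) : ContDiff ℝ (⊤ : ℕ∞) (primitive g) :=
  g.hasCompactSupport.contDiff_convolution_right (ContinuousLinearMap.mul ℝ ℝ)
    locallyIntegrable_quadrant g.contDiff

theorem fderiv_primitive (g : TestFn) (w x : ℝ × ℝ) :
    fderiv ℝ (primitive g) x w = primitive (∂_{w} g) x := by
  have hg1 : ContDiff ℝ 1 g := g.contDiff.of_le (by simp)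
  have h := g.hasCompactSupport.hasFDerivAt_convolution_right (ContinuousLinearMap.mul ℝ ℝ)
    locallyIntegrable_quadrant hg1 x
  have h' : HasFDerivAt (primitive g) _ x := h
  rw [h'.fderiv, convolution_precompR_apply _ locallyIntegrable_quadrant
    (g.hasCompactSupport.fderiv ℝ) (hg1.continuous_fderiv one_ne_zero)]
  refine integral_congr_ae (Eventually.of_forall fun t => ?_)
  simp [lineDeriv_testFn]

/-- The indicator of the quadrant is a fundamental solution of `∂₁∂₂`: Fubini reduces the
convolution to two ray integrals. -/
theorem primitive_lineDeriv_lineDeriv (g : TestFn) (x : ℝ × ℝ) :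
    primitive (∂_{((0, 1) : ℝ × ℝ)} (∂_{((1, 0) : ℝ × ℝ)} g)) x = g x := by
  set h : TestFn := ∂_{((0, 1) : ℝ × ℝ)} (∂_{((1, 0) : ℝ × ℝ)} g) with hh
  have hi : Integrable (fun t => h (x - t)) (volume : Measure (ℝ × ℝ)) :=
    (h.continuous.integrable_of_hasCompactSupport h.hasCompactSupport).comp_sub_left x
  have h1 : primitive h x = ∫ t in Ioi (0 : ℝ) ×ˢ Ioi (0 : ℝ), h (x - t) := by
    rw [← integral_indicator (measurableSet_Ioi.prod measurableSet_Ioi)]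
    refine integral_congr_ae (Eventually.of_forall fun t => ?_)
    by_cases ht : t ∈ Ioi (0 : ℝ) ×ˢ Ioi (0 : ℝ)
    · simp only [quadrant, indicator_of_mem ht, Pi.one_apply, one_mul]
    · simp only [quadrant, indicator_of_notMem ht, zero_mul]
  rw [h1, Measure.volume_eq_prod, setIntegral_prod _ hi.integrableOn]
  rw [← integral_Ioi_lineDeriv g x (1, 0) (by simp)]
  refine setIntegral_congr_fun measurableSet_Ioi fun s _ => ?_
  rw [← integral_Ioi_lineDeriv (∂_{((1, 0) : ℝ × ℝ)} g) (x - s • (1, 0)) (0, 1) (by simp)]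
  refine setIntegral_congr_fun measurableSet_Ioi fun t _ => ?_
  simp only [hh]
  congr 1
  ext <;> simp

/-- A distribution that vanishes outside the square is determined by its mixed derivative. -/
theorem eq_zero_of_DD_eq_zero {f : Distr} (hf : Distribution.IsVanishingOn f Kᶜ)
    (h : DD f = 0) : f = 0 := by
  ext ψ
  -- On a ball around `K` the mixed derivative of this test function is `ψ` itself, which is all
  -- that `f` sees.
  have h1 : DD f (localize (primitive ψ) (contDiff_primitive ψ)) = 0 := by rw [h]; rfl
  rw [DD_apply] at h1
  change f ψ = 0
  rw [← h1]
  refine apply_eq_of_eqOn_ball hf fun x hx => ?_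
  rw [lineDeriv_lineDeriv_localize _ _ _ _ hx]
  simp only [fderiv_primitive]
  rw [primitive_lineDeriv_lineDeriv]

/-! ### Measures in the square with vanishing marginals -/

theorem ae_mem_K {m : SignedMeasure (ℝ × ℝ)} (hm : m ∈ MK) : ∀ᵐ x ∂m.variation, x ∈ K :=
  hm

theorem integrable_of_continuous {m : SignedMeasure (ℝ × ℝ)} (hm : m ∈ MK) {g : ℝ × ℝ → ℝ}
    (hg : Continuous g) : m.Integrable g := by
  obtain ⟨C, hC⟩ := isCompact_K.exists_bound_of_continuousOn hg.continuousOn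
  refine Integrable.of_bound hg.aestronglyMeasurable C ?_
  filter_upwards [ae_mem_K hm] with x hx using hC x hx

theorem integral_congr_on_K {m : SignedMeasure (ℝ × ℝ)} (hm : m ∈ MK) {g h : ℝ × ℝ → ℝ}
    (hgh : EqOn g h K) : ∫ᵛ x, g x ∂•m = ∫ᵛ x, h x ∂•m := by
  refine VectorMeasure.integral_congr_ae ?_
  filter_upwards [ae_mem_K hm] with x hx using hgh hx

/-- The measures in `M(K)` with vanishing marginals. -/
structure HasZeroMarginals (m : SignedMeasure (ℝ × ℝ)) : Prop where
  mem : m ∈ MK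
  fst : m.map Prod.fst = 0
  snd : m.map Prod.snd = 0

theorem integral_map_of_continuous {m : SignedMeasure (ℝ × ℝ)} (hm : m ∈ MK)
    {p : ℝ × ℝ → ℝ} (hp : Continuous p) {u : ℝ → ℝ} (hu : Continuous u) :
    ∫ᵛ t, u t ∂•(m.map p) = ∫ᵛ x, u (p x) ∂•m :=
  VectorMeasure.integral_map hp.measurable hu.aestronglyMeasurable
    (integrable_of_continuous hm (hu.comp hp))

theorem HasZeroMarginals.integral_fst {m : SignedMeasure (ℝ × ℝ)} (hm : HasZeroMarginals m)
    {u : ℝ → ℝ} (hu : Continuous u) : ∫ᵛ x, u x.1 ∂•m = 0 := by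
  rw [← integral_map_of_continuous hm.mem continuous_fst hu, hm.fst]
  simp

theorem HasZeroMarginals.integral_snd {m : SignedMeasure (ℝ × ℝ)} (hm : HasZeroMarginals m)
    {u : ℝ → ℝ} (hu : Continuous u) : ∫ᵛ x, u x.2 ∂•m = 0 := by
  rw [← integral_map_of_continuous hm.mem continuous_snd hu, hm.snd]
  simp

theorem integral_localize {m : SignedMeasure (ℝ × ℝ)} (hm : m ∈ MK) (G : ℝ × ℝ → ℝ)
    (hG : ContDiff ℝ (⊤ : ℕ∞) G) : ∫ᵛ x, localize G hG x ∂•m = ∫ᵛ x, G x ∂•m :=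
  integral_congr_on_K hm fun _ hx => localize_of_mem (K_subset_ball hx)

/-- A function of one coordinate has zero mixed derivative. Stated for a bare measure so that it
serves both `DD f` and the measure obtained from a dual functional. -/
theorem hasZeroMarginals_of_integral_localize {m : SignedMeasure (ℝ × ℝ)} (hm : m ∈ MK)
    (h : ∀ (G : ℝ × ℝ → ℝ) (hG : ContDiff ℝ (⊤ : ℕ∞) G),
      (∀ x, fderiv ℝ (fun y => fderiv ℝ G y (1, 0)) x (0, 1) = 0) →
        ∫ᵛ x, localize G hG x ∂•m = 0) : HasZeroMarginals m := by
  refine ⟨hm, ?_, ?_⟩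
  · refine eq_zero_of_integral_contDiff _ fun u hu _ => ?_
    rw [integral_map_of_continuous hm continuous_fst hu.continuous,
      ← integral_localize hm (fun x => u x.1) (hu.comp contDiff_fst)]
    refine h _ _ fun x => ?_
    have h1 : ∀ y : ℝ × ℝ, fderiv ℝ (fun y : ℝ × ℝ => u y.1) y (1, 0) = deriv u y.1 := by
      intro y
      have := ((hu.differentiable (by simp) y.1).hasDerivAt).comp_hasFDerivAt y
        (hasFDerivAt_fst (𝕜 := ℝ) (p := y))
      have h2 : HasFDerivAt (fun y : ℝ × ℝ => u y.1) _ y := this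
      rw [h2.fderiv]
      simp
    simp only [h1]
    have hu' : ContDiff ℝ (⊤ : ℕ∞) (deriv u) := (contDiff_infty_iff_deriv.1 hu).2
    have := ((hu'.differentiable (by simp) x.1).hasDerivAt).comp_hasFDerivAt x
      (hasFDerivAt_fst (𝕜 := ℝ) (p := x))
    have h2 : HasFDerivAt (fun y : ℝ × ℝ => deriv u y.1) _ x := this
    rw [h2.fderiv]
    simp
  · refine eq_zero_of_integral_contDiff _ fun u hu _ => ?_
    rw [integral_map_of_continuous hm continuous_snd hu.continuous,
      ← integral_localize hm (fun x => u x.2) (hu.comp contDiff_snd)]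
    refine h _ _ fun x => ?_
    have h1 : ∀ y : ℝ × ℝ, fderiv ℝ (fun y : ℝ × ℝ => u y.2) y (1, 0) = 0 := by
      intro y
      have := ((hu.differentiable (by simp) y.2).hasDerivAt).comp_hasFDerivAt y
        (hasFDerivAt_snd (𝕜 := ℝ) (p := y))
      have h2 : HasFDerivAt (fun y : ℝ × ℝ => u y.2) _ y := this
      rw [h2.fderiv]
      simp
    simp [h1]

theorem hasZeroMarginals_of_vanishing {f : Distr} (hf : Distribution.IsVanishingOn f Kᶜ)
    {m : SignedMeasure (ℝ × ℝ)} (hm : m ∈ MK) (hfm : IsRepresentedBy (DD f) m) :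
    HasZeroMarginals m :=
  hasZeroMarginals_of_integral_localize hm fun G hG h => by
    rw [← hfm, DD_localize_eq_zero hf G hG h]

/-! ### Partial primitives -/

/-- The integral over the first variable up to `1`. -/
def intFst (φ : ℝ × ℝ → ℝ) (p : ℝ × ℝ) : ℝ := ∫ x in p.1..1, φ (x, p.2)

/-- The integral over the second variable up to `1`. -/
def intSnd (φ : ℝ × ℝ → ℝ) (p : ℝ × ℝ) : ℝ := ∫ y in p.2..1, φ (p.1, y)

theorem continuous_intFst {φ : ℝ × ℝ → ℝ} (hφ : Continuous φ) : Continuous (intFst φ) := by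
  have h : intFst φ = fun p => -∫ x in 1..p.1, φ (x, p.2) := by
    ext p
    rw [intFst, intervalIntegral.integral_symm]
  rw [h]
  refine (intervalIntegral.continuous_parametric_intervalIntegral_of_continuous ?_
    continuous_fst).neg
  exact hφ.comp (by fun_prop : Continuous fun q : (ℝ × ℝ) × ℝ => (q.2, q.1.2))

theorem continuous_intSnd {φ : ℝ × ℝ → ℝ} (hφ : Continuous φ) : Continuous (intSnd φ) := by
  have h : intSnd φ = fun p => -∫ y in 1..p.2, φ (p.1, y) := by
    ext p
    rw [intSnd, intervalIntegral.integral_symm]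
  rw [h]
  refine (intervalIntegral.continuous_parametric_intervalIntegral_of_continuous ?_
    continuous_snd).neg
  exact hφ.comp (by fun_prop : Continuous fun q : (ℝ × ℝ) × ℝ => (q.1.1, q.2))

theorem intervalIntegrable_fst {φ : ℝ × ℝ → ℝ} (hφ : Continuous φ) (y a b : ℝ) :
    IntervalIntegrable (fun x => φ (x, y)) volume a b :=
  Continuous.intervalIntegrable (by fun_prop) _ _

theorem intervalIntegrable_snd {φ : ℝ × ℝ → ℝ} (hφ : Continuous φ) (x a b : ℝ) :
    IntervalIntegrable (fun y => φ (x, y)) volume a b :=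
  Continuous.intervalIntegrable (by fun_prop) _ _

theorem intFst_add {φ χ : ℝ × ℝ → ℝ} (hφ : Continuous φ) (hχ : Continuous χ) :
    intFst (φ + χ) = intFst φ + intFst χ :=
  funext fun _ => intervalIntegral.integral_add (intervalIntegrable_fst hφ _ _ _)
    (intervalIntegrable_fst hχ _ _ _)

theorem intSnd_add {φ χ : ℝ × ℝ → ℝ} (hφ : Continuous φ) (hχ : Continuous χ) :
    intSnd (φ + χ) = intSnd φ + intSnd χ :=
  funext fun _ => intervalIntegral.integral_add (intervalIntegrable_snd hφ _ _ _)
    (intervalIntegrable_snd hχ _ _ _)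

theorem intFst_smul (c : ℝ) (φ : ℝ × ℝ → ℝ) : intFst (c • φ) = c • intFst φ :=
  funext fun _ => intervalIntegral.integral_smul c _

theorem intSnd_smul (c : ℝ) (φ : ℝ × ℝ → ℝ) : intSnd (c • φ) = c • intSnd φ :=
  funext fun _ => intervalIntegral.integral_smul c _

/-- The interval `[s, 1]` stays inside `[0, 1]` and has length at most one. Hence partial
integration up to `1` only uses values on `K` and is a contraction there. -/
theorem abs_intervalIntegral_le {u : ℝ → ℝ} {C s : ℝ} (hs : s ∈ Icc (0 : ℝ) 1)
    (h : ∀ x ∈ Icc (0 : ℝ) 1, |u x| ≤ C) : |∫ x in s..1, u x| ≤ C := by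
  have hC : 0 ≤ C := (abs_nonneg _).trans (h s hs)
  have h1 : ‖∫ x in s..1, u x‖ ≤ C * |1 - s| := by
    refine intervalIntegral.norm_integral_le_of_norm_le_const fun x hx => ?_
    rw [uIoc_of_le hs.2] at hx
    exact h x ⟨hs.1.trans hx.1.le, hx.2⟩
  rw [Real.norm_eq_abs, abs_of_nonneg (sub_nonneg.2 hs.2)] at h1
  exact h1.trans (mul_le_of_le_one_right hC (by linarith [hs.1]))

theorem abs_intFst_le {φ : ℝ × ℝ → ℝ} {C : ℝ} (h : ∀ x ∈ K, |φ x| ≤ C) :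
    ∀ x ∈ K, |intFst φ x| ≤ C := fun p hp =>
  abs_intervalIntegral_le (u := fun x => φ (x, p.2)) hp.1 fun _ hx => h _ ⟨hx, hp.2⟩

theorem abs_intSnd_le {φ : ℝ × ℝ → ℝ} {C : ℝ} (h : ∀ x ∈ K, |φ x| ≤ C) :
    ∀ x ∈ K, |intSnd φ x| ≤ C := fun p hp =>
  abs_intervalIntegral_le (u := fun y => φ (p.1, y)) hp.2 fun _ hy => h _ ⟨hp.1, hy⟩

theorem intFst_intSnd_comm {φ : ℝ × ℝ → ℝ} (hφ : Continuous φ) :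
    intFst (intSnd φ) = intSnd (intFst φ) := by
  ext p
  refine intervalIntegral_intervalIntegral_swap (F := fun x y => φ (x, y)) ?_
  exact (hφ.continuousOn.integrableOn_compact
    (isCompact_uIcc.prod isCompact_uIcc)).mono_set
      (Set.prod_mono uIoc_subset_uIcc uIoc_subset_uIcc)

theorem intFst_lineDeriv (ψ : TestFn) (p : ℝ × ℝ) :
    intFst (∂_{((1, 0) : ℝ × ℝ)} ψ : TestFn) p = ψ (1, p.2) - ψ p := by
  refine intervalIntegral.integral_eq_sub_of_hasDerivAt (f := fun x => ψ (x, p.2))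
    (fun x _ => ?_) (intervalIntegrable_fst (∂_{((1, 0) : ℝ × ℝ)} ψ : TestFn).continuous _ _ _)
  have h1 : HasFDerivAt ψ (fderiv ℝ ψ (x, p.2)) (x, p.2) :=
    (ψ.contDiff.differentiable (by simp) _).hasFDerivAt
  have h2 := h1.comp_hasDerivAt x ((hasDerivAt_id x).prodMk (hasDerivAt_const x p.2))
  rw [lineDeriv_testFn]
  exact h2

theorem intSnd_lineDeriv (ψ : TestFn) (p : ℝ × ℝ) :
    intSnd (∂_{((0, 1) : ℝ × ℝ)} ψ : TestFn) p = ψ (p.1, 1) - ψ p := by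
  refine intervalIntegral.integral_eq_sub_of_hasDerivAt (f := fun y => ψ (p.1, y))
    (fun y _ => ?_) (intervalIntegrable_snd (∂_{((0, 1) : ℝ × ℝ)} ψ : TestFn).continuous _ _ _)
  have h1 : HasFDerivAt ψ (fderiv ℝ ψ (p.1, y)) (p.1, y) :=
    (ψ.contDiff.differentiable (by simp) _).hasFDerivAt
  have h2 := h1.comp_hasDerivAt y ((hasDerivAt_const y p.1).prodMk (hasDerivAt_id y))
  rw [lineDeriv_testFn]
  exact h2

/-! ### The distribution with a given mixed derivative -/

theorem abs_integral_le_of_forall_mem_K {m : SignedMeasure (ℝ × ℝ)} (hm : m ∈ MK)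
    {g : ℝ × ℝ → ℝ} {C : ℝ} (h : ∀ x ∈ K, |g x| ≤ C) : |∫ᵛ x, g x ∂•m| ≤ C * tvNorm m :=
  abs_integral_le m ((ae_mem_K hm).mono h)

/-- The functional `φ ↦ ∫ A φ dm`. -/
def functionalOfOperator {m : SignedMeasure (ℝ × ℝ)} (hm : m ∈ MK)
    (A : (ℝ × ℝ → ℝ) → ℝ × ℝ → ℝ)
    (hcont : ∀ φ, Continuous φ → Continuous (A φ))
    (hadd : ∀ φ χ, Continuous φ → Continuous χ → A (φ + χ) = A φ + A χ)
    (hsmul : ∀ (c : ℝ) φ, Continuous φ → A (c • φ) = c • A φ)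
    (hbound : ∀ φ (C : ℝ), (∀ x ∈ K, |φ x| ≤ C) → ∀ x ∈ K, |A φ x| ≤ C) :
    BoundedContinuousFunction (ℝ × ℝ) ℝ →L[ℝ] ℝ :=
  LinearMap.mkContinuous
    { toFun := fun φ => ∫ᵛ x, A φ x ∂•m
      map_add' := fun φ χ => by
        rw [BoundedContinuousFunction.coe_add, hadd _ _ φ.continuous χ.continuous]
        exact VectorMeasure.integral_add (integrable_of_continuous hm (hcont _ φ.continuous))
          (integrable_of_continuous hm (hcont _ χ.continuous))
      map_smul' := fun c φ => by
        rw [BoundedContinuousFunction.coe_smul]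
        change ∫ᵛ x, A (c • ⇑φ) x ∂•m = _
        rw [hsmul _ _ φ.continuous]
        exact VectorMeasure.integral_smul _ m _ c }
    (tvNorm m) fun φ => by
      rw [mul_comm]
      exact abs_integral_le_of_forall_mem_K hm
        (hbound φ _ fun x _ => φ.norm_coe_le_norm x)

/-- A measure that represents the functional `φ ↦ ∫ A φ dm`. -/
theorem exists_measure_of_operator {m : SignedMeasure (ℝ × ℝ)} (hm : m ∈ MK)
    (A : (ℝ × ℝ → ℝ) → ℝ × ℝ → ℝ)
    (hcont : ∀ φ, Continuous φ → Continuous (A φ))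
    (hadd : ∀ φ χ, Continuous φ → Continuous χ → A (φ + χ) = A φ + A χ)
    (hsmul : ∀ (c : ℝ) φ, Continuous φ → A (c • φ) = c • A φ)
    (hbound : ∀ φ (C : ℝ), (∀ x ∈ K, |φ x| ≤ C) → ∀ x ∈ K, |A φ x| ≤ C) :
    ∃ n ∈ MK, tvNorm n ≤ tvNorm m ∧ ∀ ψ : TestFn, ∫ᵛ x, ψ x ∂•n = ∫ᵛ x, A ψ x ∂•m := by
  set L₀ := functionalOfOperator hm A hcont hadd hsmul hbound
  set L : C₀(ℝ × ℝ, ℝ) →L[ℝ] ℝ := LinearMap.mkContinuous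
    { toFun := fun φ => L₀ φ.toBCF
      map_add' := fun φ χ => map_add L₀ φ.toBCF χ.toBCF
      map_smul' := fun c φ => map_smul L₀ c φ.toBCF } (tvNorm m) fun φ => by
        rw [mul_comm]
        exact abs_integral_le_of_forall_mem_K hm
          (hbound φ _ fun x _ => abs_C0_le φ x)
  obtain ⟨n, hn⟩ := exists_integralC0_eq L
  have hrep : ∀ g : ℝ × ℝ → ℝ, Continuous g → HasCompactSupport g →
      ∫ᵛ x, g x ∂•n = ∫ᵛ x, A g x ∂•m := by
    intro g hg hgc
    exact DFunLike.congr_fun hn (⟨⟨g, hg⟩, hgc.is_zero_at_infty⟩ : C₀(ℝ × ℝ, ℝ))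
  refine ⟨n, ?_, ?_, fun ψ => hrep ψ ψ.continuous ψ.hasCompactSupport⟩
  -- The bound with constant `0` says that `A g` vanishes on `K` whenever `g` does, so the support
  -- stays in `K`.
  · refine variation_eq_zero_of_integral_contDiff n isClosed_K.isOpen_compl
      fun g hg hgc hgK => ?_
    rw [hrep g hg.continuous hgc]
    have h := abs_integral_le_of_forall_mem_K hm (hbound g 0 fun x hx => by
      rw [image_eq_zero_of_notMem_tsupport fun hx' => hgK hx' hx, abs_zero])
    rw [zero_mul] at h
    exact abs_nonpos_iff.1 h
  · rw [← norm_integralC0, hn]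
    exact LinearMap.mkContinuous_norm_le _ (tvNorm_nonneg m) _

variable {m : SignedMeasure (ℝ × ℝ)}

/-- The distribution with the mixed derivative `m`. -/
def distrOfMeasure (hm : m ∈ MK) : Distr where
  toLinearMap := ((functionalOfOperator hm (fun φ => intFst (intSnd φ))
    (fun _ hφ => continuous_intFst (continuous_intSnd hφ))
    (fun _ _ hφ hχ => by
      rw [intSnd_add hφ hχ, intFst_add (continuous_intSnd hφ) (continuous_intSnd hχ)])
    (fun c φ _ => by rw [intSnd_smul, intFst_smul])
    (fun _ _ h => abs_intFst_le (abs_intSnd_le h))).comp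
      (TestFunction.toBoundedContinuousFunctionCLM ℝ : TestFn →L[ℝ] _)).toLinearMap
  cont := ContinuousLinearMap.continuous _

theorem distrOfMeasure_apply (hm : m ∈ MK) (ψ : TestFn) :
    distrOfMeasure hm ψ = ∫ᵛ x, intFst (intSnd ψ) x ∂•m := rfl

/-- For `p` in `K` the double integral runs over `[p.1, 1] × [p.2, 1] ⊆ K`, where `ψ` is zero. The
marginals play no role here. -/
theorem distrOfMeasure_isVanishingOn (hm : m ∈ MK) :
    Distribution.IsVanishingOn (distrOfMeasure hm) Kᶜ := by
  intro ψ hψ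
  have h := abs_integral_le_of_forall_mem_K hm (abs_intFst_le (abs_intSnd_le (φ := ψ) (C := 0)
    fun x hx => by
      rw [image_eq_zero_of_notMem_tsupport fun hx' => hψ hx' hx, abs_zero]))
  rw [zero_mul] at h
  exact abs_nonpos_iff.1 h

/-- Functions that differ by functions of one variable have the same integral. -/
theorem HasZeroMarginals.integral_eq (hm : HasZeroMarginals m) {g h : ℝ × ℝ → ℝ}
    (hh : Continuous h) {u v : ℝ → ℝ} (hu : Continuous u) (hv : Continuous v)
    (hg : ∀ p, g p = h p + (u p.1 + v p.2)) : ∫ᵛ x, g x ∂•m = ∫ᵛ x, h x ∂•m := by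
  have hu' : m.Integrable fun p : ℝ × ℝ => u p.1 :=
    integrable_of_continuous hm.mem (hu.comp continuous_fst)
  have hv' : m.Integrable fun p : ℝ × ℝ => v p.2 :=
    integrable_of_continuous hm.mem (hv.comp continuous_snd)
  have huv' : m.Integrable fun p : ℝ × ℝ => u p.1 + v p.2 := hu'.add hv'
  simp only [hg]
  rw [VectorMeasure.integral_fun_add (integrable_of_continuous hm.mem hh) huv',
    VectorMeasure.integral_fun_add (f := fun p : ℝ × ℝ => u p.1) (g := fun p => v p.2) hu' hv',
    hm.integral_fst hu, hm.integral_snd hv, add_zero, add_zero]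

/-- Integrating the mixed derivative back gives `ψ p - ψ (p.1, 1) - ψ (1, p.2) + ψ (1, 1)`; the zero
marginals remove the boundary terms. -/
theorem DD_distrOfMeasure (hm : HasZeroMarginals m) :
    IsRepresentedBy (DD (distrOfMeasure hm.mem)) m := by
  intro ψ
  rw [DD_apply, distrOfMeasure_apply]
  have hψ := ψ.continuous
  have h1 : intSnd (∂_{((0, 1) : ℝ × ℝ)} (∂_{((1, 0) : ℝ × ℝ)} ψ : TestFn) : TestFn) =
      (fun p => (∂_{((1, 0) : ℝ × ℝ)} ψ : TestFn) (p.1, 1)) +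
        (-1 : ℝ) • ⇑(∂_{((1, 0) : ℝ × ℝ)} ψ : TestFn) := by
    ext p
    rw [intSnd_lineDeriv]
    simp [sub_eq_add_neg]
  have hc := (∂_{((1, 0) : ℝ × ℝ)} ψ : TestFn).continuous
  rw [h1, intFst_add (by fun_prop) (hc.const_smul _), intFst_smul]
  refine hm.integral_eq hψ (u := fun s => ψ (1, 1) - ψ (s, 1)) (v := fun t => -ψ (1, t))
    (by fun_prop) (by fun_prop) fun p => ?_
  have h2 : intFst (fun p => (∂_{((1, 0) : ℝ × ℝ)} ψ : TestFn) (p.1, 1)) p =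
      intFst (∂_{((1, 0) : ℝ × ℝ)} ψ : TestFn) (p.1, 1) := rfl
  simp only [Pi.add_apply, Pi.smul_apply, h2, intFst_lineDeriv, smul_eq_mul]
  ring

/-- The integration in the second variable undoes the derivative. The boundary term depends on `p.1`
alone, and the two minus signs cancel. -/
theorem ID_distrOfMeasure_apply (hm : HasZeroMarginals m) (ψ : TestFn) :
    ID (distrOfMeasure hm.mem) ψ = ∫ᵛ x, intFst ψ x ∂•m := by
  change (∂_{((0, 1) : ℝ × ℝ)} (distrOfMeasure hm.mem)) ψ = _
  have hψ := ψ.continuous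
  have h1 : intSnd (∂_{((0, 1) : ℝ × ℝ)} ψ : TestFn) =
      (fun p => ψ (p.1, 1)) + (-1 : ℝ) • ⇑ψ := by
    ext p
    rw [intSnd_lineDeriv]
    simp [sub_eq_add_neg]
  rw [Distribution.lineDerivOp_apply_apply, map_neg, distrOfMeasure_apply, h1,
    intFst_add (by fun_prop) (hψ.const_smul _), intFst_smul,
    ← VectorMeasure.integral_fun_neg]
  refine hm.integral_eq (continuous_intFst hψ) (u := fun s => -intFst ψ (s, 1)) (v := 0)
    ?_ continuous_const fun p => ?_
  · have := continuous_intFst hψ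
    fun_prop
  · have h2 : intFst (fun p => ψ (p.1, 1)) p = intFst ψ (p.1, 1) := rfl
    simp [h2]

theorem DI_distrOfMeasure_apply (hm : HasZeroMarginals m) (ψ : TestFn) :
    DI (distrOfMeasure hm.mem) ψ = ∫ᵛ x, intSnd ψ x ∂•m := by
  change (∂_{((1, 0) : ℝ × ℝ)} (distrOfMeasure hm.mem)) ψ = _
  have hψ := ψ.continuous
  have h1 : intFst (∂_{((1, 0) : ℝ × ℝ)} ψ : TestFn) =
      (fun p => ψ (1, p.2)) + (-1 : ℝ) • ⇑ψ := by
    ext p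
    rw [intFst_lineDeriv]
    simp [sub_eq_add_neg]
  -- Fubini brings the integration in the first variable next to the derivative that it cancels.
  rw [Distribution.lineDerivOp_apply_apply, map_neg, distrOfMeasure_apply,
    intFst_intSnd_comm (∂_{((1, 0) : ℝ × ℝ)} ψ : TestFn).continuous, h1,
    intSnd_add (by fun_prop) (hψ.const_smul _), intSnd_smul,
    ← VectorMeasure.integral_fun_neg]
  refine hm.integral_eq (continuous_intSnd hψ) (u := 0) (v := fun t => -intSnd ψ (1, t))
    continuous_const ?_ fun p => ?_
  · have := continuous_intSnd hψ
    fun_prop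
  · have h2 : intSnd (fun p => ψ (1, p.2)) p = intSnd ψ (1, p.2) := rfl
    simp [h2]

theorem exists_measure_ID_distrOfMeasure (hm : HasZeroMarginals m) :
    ∃ n ∈ MK, tvNorm n ≤ tvNorm m ∧ IsRepresentedBy (ID (distrOfMeasure hm.mem)) n := by
  obtain ⟨n, hn, hnm, h⟩ := exists_measure_of_operator hm.mem intFst
    (fun _ => continuous_intFst) (fun _ _ => intFst_add) (fun c φ _ => intFst_smul c φ)
    (fun _ _ => abs_intFst_le)
  exact ⟨n, hn, hnm, fun ψ => by rw [h, ID_distrOfMeasure_apply hm]⟩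

theorem exists_measure_DI_distrOfMeasure (hm : HasZeroMarginals m) :
    ∃ n ∈ MK, tvNorm n ≤ tvNorm m ∧ IsRepresentedBy (DI (distrOfMeasure hm.mem)) n := by
  obtain ⟨n, hn, hnm, h⟩ := exists_measure_of_operator hm.mem intSnd
    (fun _ => continuous_intSnd) (fun _ _ => intSnd_add) (fun c φ _ => intSnd_smul c φ)
    (fun _ _ => abs_intSnd_le)
  exact ⟨n, hn, hnm, fun ψ => by rw [h, DI_distrOfMeasure_apply hm]⟩

/-! ### The native space -/

theorem measureOf_eq {T : Distr} {m : SignedMeasure (ℝ × ℝ)} (hm : m ∈ MK)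
    (h : IsRepresentedBy T m) : measureOf T = m := by
  have h' : ∃ m ∈ MK, IsRepresentedBy T m := ⟨m, hm, h⟩
  rw [measureOf, dif_pos h']
  exact h'.choose_spec.2.unique h

theorem normM_eq {T : Distr} {m : SignedMeasure (ℝ × ℝ)} (hm : m ∈ MK)
    (h : IsRepresentedBy T m) : normM T = tvNorm m := by
  rw [normM, measureOf_eq hm h]

theorem normM_nonneg (T : Distr) : 0 ≤ normM T := tvNorm_nonneg _

theorem tvNorm_add_le (m n : SignedMeasure (ℝ × ℝ)) : tvNorm (m + n) ≤ tvNorm m + tvNorm n := by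
  rw [tvNorm, tvNorm, tvNorm, ← ENNReal.toReal_add (measure_ne_top _ _) (measure_ne_top _ _)]
  exact ENNReal.toReal_mono (by finiteness) (VectorMeasure.variation_add_le univ)

theorem tvNorm_smul (c : ℝ) (m : SignedMeasure (ℝ × ℝ)) : tvNorm (c • m) = |c| * tvNorm m := by
  simp [tvNorm, VectorMeasure.variation_smul]

theorem IsRepresentedBy.add {S T : Distr} {m n : SignedMeasure (ℝ × ℝ)}
    (hm : IsRepresentedBy S m) (hn : IsRepresentedBy T n) : IsRepresentedBy (S + T) (m + n) := by
  intro ψ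
  rw [VectorMeasure.integral_add_vectorMeasure (integrable_testFn m ψ) (integrable_testFn n ψ),
    ← hm, ← hn]
  rfl

theorem IsRepresentedBy.smul {T : Distr} {m : SignedMeasure (ℝ × ℝ)}
    (hm : IsRepresentedBy T m) (c : ℝ) : IsRepresentedBy (c • T) (c • m) := by
  intro ψ
  rw [VectorMeasure.integral_smul_vectorMeasure, ← hm]
  rfl

theorem normM_add_le {S T : Distr} (hS : ∃ m ∈ MK, IsRepresentedBy S m)
    (hT : ∃ m ∈ MK, IsRepresentedBy T m) : normM (S + T) ≤ normM S + normM T := by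
  obtain ⟨m, hm, hSm⟩ := hS
  obtain ⟨n, hn, hTn⟩ := hT
  rw [normM_eq hm hSm, normM_eq hn hTn, normM_eq (MK.add_mem hm hn) (hSm.add hTn)]
  exact tvNorm_add_le m n

theorem normM_smul {T : Distr} (hT : ∃ m ∈ MK, IsRepresentedBy T m) (c : ℝ) :
    normM (c • T) = |c| * normM T := by
  obtain ⟨m, hm, hTm⟩ := hT
  rw [normM_eq hm hTm, normM_eq (MK.smul_mem c hm) (hTm.smul c), tvNorm_smul]

theorem hasZeroMarginals_measureOf (f : nativeSpace) :
    HasZeroMarginals (measureOf (DD f)) := by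
  obtain ⟨m, hm, hfm⟩ := f.2.1
  rw [measureOf_eq hm hfm]
  exact hasZeroMarginals_of_vanishing f.2.2 hm hfm

theorem eq_of_isRepresentedBy {f g : Distr} (hf : Distribution.IsVanishingOn f Kᶜ)
    (hg : Distribution.IsVanishingOn g Kᶜ) {m : SignedMeasure (ℝ × ℝ)}
    (hfm : IsRepresentedBy (DD f) m) (hgm : IsRepresentedBy (DD g) m) : f = g := by
  rw [← sub_eq_zero]
  refine eq_zero_of_DD_eq_zero (fun ψ hψ => ?_) ?_
  · change f ψ - g ψ = 0
    rw [hf ψ hψ, hg ψ hψ, sub_zero]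
  · rw [map_sub]
    ext ψ
    change DD f ψ - DD g ψ = 0
    rw [hfm, hgm, sub_self]

/-- Gives every element of the native space the explicit integral formula, from which its first
derivatives are read off. -/
theorem eq_distrOfMeasure (f : nativeSpace) :
    (f : Distr) = distrOfMeasure (hasZeroMarginals_measureOf f).mem :=
  eq_of_isRepresentedBy f.2.2 (distrOfMeasure_isVanishingOn _) (isRepresentedBy_measureOf f)
    (DD_distrOfMeasure (hasZeroMarginals_measureOf f))

theorem exists_measure_ID (f : nativeSpace) :
    ∃ n ∈ MK, tvNorm n ≤ normM (DD f) ∧ IsRepresentedBy (ID f) n := by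
  obtain ⟨n, hn, hle, h⟩ := exists_measure_ID_distrOfMeasure (hasZeroMarginals_measureOf f)
  rw [← eq_distrOfMeasure] at h
  exact ⟨n, hn, hle, h⟩

theorem exists_measure_DI (f : nativeSpace) :
    ∃ n ∈ MK, tvNorm n ≤ normM (DD f) ∧ IsRepresentedBy (DI f) n := by
  obtain ⟨n, hn, hle, h⟩ := exists_measure_DI_distrOfMeasure (hasZeroMarginals_measureOf f)
  rw [← eq_distrOfMeasure] at h
  exact ⟨n, hn, hle, h⟩

theorem exists_mem_MK_ID (f : nativeSpace) : ∃ n ∈ MK, IsRepresentedBy (ID f) n := by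
  obtain ⟨n, hn, -, h⟩ := exists_measure_ID f
  exact ⟨n, hn, h⟩

theorem exists_mem_MK_DI (f : nativeSpace) : ∃ n ∈ MK, IsRepresentedBy (DI f) n := by
  obtain ⟨n, hn, -, h⟩ := exists_measure_DI f
  exact ⟨n, hn, h⟩

theorem normGrad_nonneg (f : nativeSpace) : 0 ≤ normGrad f :=
  add_nonneg (normM_nonneg _) (normM_nonneg _)

theorem normGrad_le (f : nativeSpace) : normGrad f ≤ 2 * normM (DD f) := by
  obtain ⟨n, hn, hle, h⟩ := exists_measure_ID f
  obtain ⟨n', hn', hle', h'⟩ := exists_measure_DI f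
  rw [normGrad, normM_eq hn h, normM_eq hn' h']
  linarith

/-- The weights give `(2 - θ)‖DD f‖`; the constant `2` works for all `θ` at once. -/
theorem normTheta_le {θ : ℝ} (hθ : θ ∈ Ioc (0 : ℝ) 1) (f : nativeSpace) :
    normTheta θ f ≤ 2 * normM (DD f) := by
  have h1 := normGrad_le f
  have h2 := normM_nonneg (DD f)
  have h3 := mul_le_mul_of_nonneg_left h1 (sub_nonneg.2 hθ.2)
  have h4 := mul_nonneg hθ.1.le h2
  rw [normTheta]
  linarith

theorem le_normTheta {θ : ℝ} (hθ : θ ∈ Ioc (0 : ℝ) 1) (f : nativeSpace) :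
    θ * normM (DD f) ≤ normTheta θ f :=
  le_add_of_nonneg_right (mul_nonneg (sub_nonneg.2 hθ.2) (normGrad_nonneg f))

theorem normM_DD_eq_zero {f : nativeSpace} (h : normM (DD f) = 0) : f = 0 := by
  have h1 : measureOf (DD f) = 0 := toReal_variation_univ_eq_zero.1 h
  have h2 := isRepresentedBy_measureOf f
  rw [h1] at h2
  exact Subtype.ext (eq_of_isRepresentedBy f.2.2 (0 : nativeSpace).2.2 h2 fun ψ => by simp)

theorem normTheta_smul (θ c : ℝ) (f : nativeSpace) :
    normTheta θ (c • f) = |c| * normTheta θ f := by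
  simp only [normTheta, normGrad, Submodule.coe_smul, map_smul]
  rw [normM_smul f.2.1, normM_smul (exists_mem_MK_ID f), normM_smul (exists_mem_MK_DI f)]
  ring

theorem isNorm_normTheta {θ : ℝ} (hθ : θ ∈ Ioc (0 : ℝ) 1) : IsNorm (normTheta θ) where
  nonneg f := (mul_nonneg hθ.1.le (normM_nonneg _)).trans (le_normTheta hθ f)
  eq_zero_iff f := by
    constructor
    · intro h
      have h1 := le_normTheta hθ f
      rw [h] at h1
      -- Here `θ > 0` is essential: the mixed derivative alone already separates points.
      exact normM_DD_eq_zero (le_antisymm (nonpos_of_mul_nonpos_right h1 hθ.1) (normM_nonneg _))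
    · rintro rfl
      have h := normTheta_smul θ 0 0
      rwa [zero_smul, abs_zero, zero_mul] at h
  smul := normTheta_smul θ
  add_le f g := by
    have h1 := normM_add_le f.2.1 g.2.1
    have h2 := normM_add_le (exists_mem_MK_ID f) (exists_mem_MK_ID g)
    have h3 := normM_add_le (exists_mem_MK_DI f) (exists_mem_MK_DI g)
    have h4 := mul_le_mul_of_nonneg_left h1 hθ.1.le
    have h5 := mul_le_mul_of_nonneg_left (add_le_add h2 h3) (sub_nonneg.2 hθ.2)
    simp only [normTheta, normGrad, Submodule.coe_add, map_add]
    linarith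

/-- The element of the native space with the mixed derivative `m`. -/
def nativeOfMeasure {m : SignedMeasure (ℝ × ℝ)} (hm : HasZeroMarginals m) : nativeSpace :=
  ⟨distrOfMeasure hm.mem, ⟨m, hm.mem, DD_distrOfMeasure hm⟩, distrOfMeasure_isVanishingOn hm.mem⟩

theorem measureOf_nativeOfMeasure {m : SignedMeasure (ℝ × ℝ)} (hm : HasZeroMarginals m) :
    measureOf (DD (nativeOfMeasure hm : Distr)) = m :=
  measureOf_eq hm.mem (DD_distrOfMeasure hm)

/-! ### Duality -/

theorem ofC0_symm_ofC0 (φ : C₀(ℝ × ℝ, ℝ)) :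
    MixedDerivC0.ofC0.symm (MixedDerivC0.ofC0 φ) = φ := LinearEquiv.symm_apply_apply _ _

theorem bracket_ofC0 (f : nativeSpace) (φ : C₀(ℝ × ℝ, ℝ)) :
    bracket f (MixedDerivC0.ofC0 φ) = integralC0 (measureOf (DD f)) φ := by
  rw [bracket, ofC0_symm_ofC0, integralC0_apply]

/-- The functional `v ↦ ⟨f, v⟩` on `[D ⊗ D]{C₀(ℝ²)}`. -/
def bracketCLM (f : nativeSpace) : StrongDual ℝ MixedDerivC0 :=
  LinearMap.mkContinuous
    ((integralC0 (measureOf (DD f))).toLinearMap ∘ₗ MixedDerivC0.ofC0.symm.toLinearMap)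
    (normM (DD f)) fun v => by
      refine ((integralC0 (measureOf (DD f))).le_opNorm _).trans (le_of_eq ?_)
      rw [norm_integralC0]
      rfl

theorem bracketCLM_apply (f : nativeSpace) (v : MixedDerivC0) : bracketCLM f v = bracket f v := rfl

theorem abs_bracket_le (f : nativeSpace) (v : MixedDerivC0) :
    |bracket f v| ≤ normM (DD f) * ‖v‖ :=
  (bracketCLM f).le_of_opNorm_le (LinearMap.mkContinuous_norm_le _ (normM_nonneg _) _) v

/-- An intersection of kernels of bounded functionals. -/
theorem isClosed_M0 : IsClosed (M0 : Set MixedDerivC0) := by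
  have h : (M0 : Set MixedDerivC0) = ⋂ f : nativeSpace, bracketCLM f ⁻¹' {0} := by
    ext v
    simp only [mem_iInter, mem_preimage, mem_singleton_iff, bracketCLM_apply]
    rfl
  rw [h]
  exact isClosed_iInter fun f => isClosed_singleton.preimage (bracketCLM f).continuous

/-- The functional on the quotient by `M0` that is induced by an element of the native space. -/
def quotientFunctional (f : nativeSpace) : StrongDual ℝ (MixedDerivC0 ⧸ M0) :=
  LinearMap.mkContinuous (M0.liftQ (bracketCLM f).toLinearMap fun _ hv => hv f)
    (normM (DD f)) fun q => by
      refine le_of_forall_pos_le_add fun ε hε => ?_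
      have hpos : 0 < normM (DD f) + 1 := by linarith [normM_nonneg (DD f)]
      -- The quotient norm is an infimum, so a nearly optimal representative is used; the `+ 1`
      -- covers `normM (DD f) = 0`.
      obtain ⟨v, rfl, hv⟩ := Submodule.Quotient.norm_mk_lt q (div_pos hε hpos)
      refine (abs_bracket_le f v).trans ?_
      calc normM (DD f) * ‖v‖
          ≤ normM (DD f) * (‖(Submodule.Quotient.mk v : MixedDerivC0 ⧸ M0)‖ +
            ε / (normM (DD f) + 1)) := mul_le_mul_of_nonneg_left hv.le (normM_nonneg _)
        _ = normM (DD f) * ‖(Submodule.Quotient.mk v : MixedDerivC0 ⧸ M0)‖ +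
            normM (DD f) * (ε / (normM (DD f) + 1)) := mul_add _ _ _
        _ ≤ normM (DD f) * ‖(Submodule.Quotient.mk v : MixedDerivC0 ⧸ M0)‖ +
            (normM (DD f) + 1) * (ε / (normM (DD f) + 1)) := by gcongr; linarith
        _ = _ := by rw [mul_div_cancel₀ _ hpos.ne']

theorem quotientFunctional_mkQ (f : nativeSpace) (v : MixedDerivC0) :
    quotientFunctional f (M0.mkQ v) = bracket f v := rfl

/-- Passing to the quotient loses nothing: the quotient map does not increase norms, so the
functional bounds `∫ φ dm` on all of `C₀`, where the best constant is the total variation. -/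
theorem norm_quotientFunctional (f : nativeSpace) : ‖quotientFunctional f‖ = normM (DD f) := by
  refine le_antisymm (LinearMap.mkContinuous_norm_le _ (normM_nonneg _) _) ?_
  refine tvNorm_le_of_forall_C0 _ (quotientFunctional f).opNorm_nonneg fun φ => ?_
  have h := (quotientFunctional f).le_opNorm (M0.mkQ (MixedDerivC0.ofC0 φ))
  rw [quotientFunctional_mkQ, bracket_ofC0, integralC0_apply] at h
  refine h.trans (mul_le_mul_of_nonneg_left ?_ (quotientFunctional f).opNorm_nonneg)
  rw [← MixedDerivC0.norm_ofC0]
  exact Submodule.Quotient.norm_mk_le _ _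

theorem measureOf_DD_add (f g : nativeSpace) :
    measureOf (DD ((f + g : nativeSpace) : Distr)) = measureOf (DD f) + measureOf (DD g) := by
  refine measureOf_eq (MK.add_mem (hasZeroMarginals_measureOf f).mem
    (hasZeroMarginals_measureOf g).mem) ?_
  rw [Submodule.coe_add, map_add]
  exact (isRepresentedBy_measureOf f).add (isRepresentedBy_measureOf g)

theorem measureOf_DD_smul (c : ℝ) (f : nativeSpace) :
    measureOf (DD ((c • f : nativeSpace) : Distr)) = c • measureOf (DD f) := by
  refine measureOf_eq (MK.smul_mem c (hasZeroMarginals_measureOf f).mem) ?_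
  rw [Submodule.coe_smul, map_smul]
  exact (isRepresentedBy_measureOf f).smul c

theorem bracket_add_left (f g : nativeSpace) (v : MixedDerivC0) :
    bracket (f + g) v = bracket f v + bracket g v := by
  rw [bracket, measureOf_DD_add]
  exact VectorMeasure.integral_add_vectorMeasure (integrable_C0 _ _) (integrable_C0 _ _)

theorem bracket_smul_left (c : ℝ) (f : nativeSpace) (v : MixedDerivC0) :
    bracket (c • f) v = c * bracket f v := by
  rw [bracket, measureOf_DD_smul]
  exact VectorMeasure.integral_smul_vectorMeasure _ _

/-- The linear map from the native space to the dual of the quotient by `M0`. -/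
def toDual : nativeSpace →ₗ[ℝ] StrongDual ℝ (MixedDerivC0 ⧸ M0) where
  toFun := quotientFunctional
  map_add' f g := by
    ext q
    obtain ⟨v, rfl⟩ := M0.mkQ_surjective q
    exact bracket_add_left f g v
  map_smul' c f := by
    ext q
    obtain ⟨v, rfl⟩ := M0.mkQ_surjective q
    exact bracket_smul_left c f v

theorem toDual_injective : Function.Injective toDual := by
  rw [← LinearMap.ker_eq_bot, LinearMap.ker_eq_bot']
  intro f hf
  refine normM_DD_eq_zero ?_
  rw [← norm_quotientFunctional]
  change ‖toDual f‖ = 0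
  rw [hf]
  exact ContinuousLinearMap.opNorm_zero

/-- A test function as an element of `C₀(ℝ²)`. -/
def testToC0 (ψ : TestFn) : C₀(ℝ × ℝ, ℝ) :=
  ⟨⟨ψ, ψ.continuous⟩, ψ.hasCompactSupport.is_zero_at_infty⟩

/-- A test function is annihilated by the native space if its integrals against all mixed
derivatives vanish. -/
theorem ofC0_mem_M0 {ψ : TestFn} (h : ∀ f : nativeSpace, DD f ψ = 0) :
    MixedDerivC0.ofC0 (testToC0 ψ) ∈ M0 := by
  intro f
  rw [bracket_ofC0, ← h f, isRepresentedBy_measureOf f ψ]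
  rfl

theorem toDual_surjective : Function.Surjective toDual := by
  intro Λ
  set ι : C₀(ℝ × ℝ, ℝ) →L[ℝ] MixedDerivC0 :=
    LinearMap.mkContinuous MixedDerivC0.ofC0.toLinearMap 1 fun φ => by
      rw [one_mul]
      exact (MixedDerivC0.norm_ofC0 φ).le
  set π : MixedDerivC0 →L[ℝ] MixedDerivC0 ⧸ M0 :=
    LinearMap.mkContinuous M0.mkQ 1 fun v => by
      rw [one_mul]
      exact Submodule.Quotient.norm_mk_le _ v
  obtain ⟨m, hm⟩ := exists_integralC0_eq ((Λ.comp π).comp ι)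
  have hmφ : ∀ φ, ∫ᵛ x, φ x ∂•m = Λ (M0.mkQ (MixedDerivC0.ofC0 φ)) :=
    fun φ => DFunLike.congr_fun hm φ
  -- The functional kills `M0`, so `m` inherits every linear condition on test functions shared by
  -- all measures `DD f`: support in `K`, and orthogonality to localized functions with zero mixed
  -- derivative.
  have hm0 : ∀ ψ : TestFn, (∀ f : nativeSpace, DD f ψ = 0) → ∫ᵛ x, ψ x ∂•m = 0 := by
    intro ψ hψ
    have h1 := hmφ (testToC0 ψ)
    have h2 : M0.mkQ (MixedDerivC0.ofC0 (testToC0 ψ)) = 0 :=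
      (Submodule.Quotient.mk_eq_zero M0).2 (ofC0_mem_M0 hψ)
    rw [h2, map_zero] at h1
    exact h1
  have hmK : m ∈ MK := by
    refine variation_eq_zero_of_integral_contDiff m isClosed_K.isOpen_compl
      fun g hg hgc hgK => hm0 ⟨g, hg, hgc, fun _ _ => trivial⟩ fun f => ?_
    rw [isRepresentedBy_measureOf f]
    have h := integral_congr_on_K (hasZeroMarginals_measureOf f).mem (g := g) (h := 0)
      fun x hx => image_eq_zero_of_notMem_tsupport fun hx' => hgK hx' hx
    refine Eq.trans h ?_
    simp
  have hmN : HasZeroMarginals m := hasZeroMarginals_of_integral_localize hmK fun G hG h =>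
    hm0 _ fun f => DD_localize_eq_zero f.2.2 G hG h
  refine ⟨nativeOfMeasure hmN, ?_⟩
  ext q
  obtain ⟨v, rfl⟩ := M0.mkQ_surjective q
  obtain ⟨φ, rfl⟩ := MixedDerivC0.ofC0.surjective v
  change bracket _ _ = _
  rw [bracket_ofC0, measureOf_nativeOfMeasure, ← hmφ]
  rfl

/-- The native space is the dual of the quotient by `M0`. -/
def dualEquiv : nativeSpace ≃ₗ[ℝ] StrongDual ℝ (MixedDerivC0 ⧸ M0) :=
  LinearEquiv.ofBijective toDual ⟨toDual_injective, toDual_surjective⟩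

theorem norm_dualEquiv (f : nativeSpace) : ‖dualEquiv f‖ = normM (DD f) :=
  norm_quotientFunctional f

/-- Completeness pulls back along a linear bijection with two-sided norm bounds; applied below with
the dual space, which is complete whatever the predual. -/
theorem isCompleteFor_of_equiv {V W : Type*} [AddCommGroup V] [Module ℝ V]
    [SeminormedAddCommGroup W] [Module ℝ W] [CompleteSpace W] (e : V ≃ₗ[ℝ] W) (N : V → ℝ)
    (hN : ∀ f, 0 ≤ N f) {a b : ℝ} (ha : 0 < a) (h₁ : ∀ f, a * ‖e f‖ ≤ N f)
    (h₂ : ∀ f, N f ≤ b * ‖e f‖) : IsCompleteFor N := by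
  intro u hu
  have hc : CauchySeq fun n => e (u n) := by
    rw [Metric.cauchySeq_iff]
    intro ε hε
    obtain ⟨n₀, hn₀⟩ := hu (a * ε) (mul_pos ha hε)
    refine ⟨n₀, fun n hn k hk => ?_⟩
    rw [dist_eq_norm, ← map_sub]
    exact lt_of_mul_lt_mul_left ((h₁ _).trans_lt (hn₀ n hn k hk)) ha.le
  obtain ⟨w, hw⟩ := cauchySeq_tendsto_of_complete hc
  refine ⟨e.symm w, ?_⟩
  have h : Tendsto (fun n => b * ‖e (u n) - w‖) atTop (𝓝 0) := by
    simpa using (tendsto_iff_norm_sub_tendsto_zero.1 hw).const_mul b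
  refine squeeze_zero (fun n => hN _) (fun n => ?_) h
  refine (h₂ _).trans (le_of_eq ?_)
  rw [map_sub, LinearEquiv.apply_symm_apply]

theorem isCompleteFor_normTheta {θ : ℝ} (hθ : θ ∈ Ioc (0 : ℝ) 1) :
    IsCompleteFor (normTheta θ) :=
  isCompleteFor_of_equiv (W := StrongDual ℝ (MixedDerivC0 ⧸ M0)) dualEquiv (normTheta θ)
    (isNorm_normTheta hθ).nonneg (b := 2) hθ.1
    (fun f => (congrArg (θ * ·) (norm_dualEquiv f)).le.trans (le_normTheta hθ f))
    (fun f => (normTheta_le hθ f).trans (congrArg (2 * ·) (norm_dualEquiv f)).ge)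

end MixedTV

end

open MixedTV
theorem mainTheorem7 :
    -- the norms are well defined and equivalent
    ((∀ f ∈ nativeSpace,
        (∃! m, m ∈ MK ∧ IsRepresentedBy (DD f) m) ∧
        (∃! m, m ∈ MK ∧ IsRepresentedBy (ID f) m) ∧
        (∃! m, m ∈ MK ∧ IsRepresentedBy (DI f) m)) ∧
      (∀ θ ∈ Set.Ioc (0 : ℝ) 1, IsNorm (normTheta θ)) ∧
      (∀ θ ∈ Set.Ioc (0 : ℝ) 1, ∀ θ' ∈ Set.Ioc (0 : ℝ) 1, ∃ C > 0,
        ∀ f : nativeSpace, normTheta θ f ≤ C * normTheta θ' f)) ∧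
    -- the native space is a Banach space
    (∀ θ ∈ Set.Ioc (0 : ℝ) 1, IsCompleteFor (normTheta θ)) ∧
    -- with the norm of the mixed derivative it is the dual of the quotient by `M0`
    IsClosed (M0 : Set MixedDerivC0) ∧
    ∃ Φ : nativeSpace ≃ₗ[ℝ] StrongDual ℝ (MixedDerivC0 ⧸ M0),
      (∀ (f : nativeSpace) (v : MixedDerivC0), Φ f (M0.mkQ v) = bracket f v) ∧
      ∀ f : nativeSpace, ‖Φ f‖ = normM (DD f) := by
  have huniq : ∀ {T : Distr}, (∃ m ∈ MK, IsRepresentedBy T m) →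
      ∃! m, m ∈ MK ∧ IsRepresentedBy T m := by
    rintro T ⟨m, hm, h⟩
    exact ⟨m, ⟨hm, h⟩, fun n hn => hn.2.unique h⟩
  refine ⟨⟨fun f hf => ⟨huniq hf.1, huniq (exists_mem_MK_ID ⟨f, hf⟩),
    huniq (exists_mem_MK_DI ⟨f, hf⟩)⟩, fun θ hθ => isNorm_normTheta hθ, ?_⟩,
    fun θ hθ => isCompleteFor_normTheta hθ, isClosed_M0, dualEquiv, fun _ _ => rfl,
    norm_dualEquiv⟩
  intro θ hθ θ' hθ'
  -- Both norms are compared with `‖DD f‖`: the factor `2` is the upper bound for `θ`, and `1 / θ'`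
  -- inverts the lower bound for `θ'`.
  refine ⟨2 / θ', div_pos two_pos hθ'.1, fun f => (normTheta_le hθ f).trans ?_⟩
  have h := mul_le_mul_of_nonneg_left (le_normTheta hθ' f) (div_pos two_pos hθ'.1).le
  refine le_trans (le_of_eq ?_) h
  rw [← mul_assoc, div_mul_cancel₀ _ hθ'.1.ne']
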